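/- Let $\mathrm{Sd}$ denote Kan's normal subdivision of simplicial sets, that is, the left Kan extension along the Yoneda embedding of the functor sending $[n]$ to the nerve of the partially ordered set of non-empty subsets of $[n]=\{0<1<\dots<n\}$, ordered by inclusion. For simplicial sets $X$ and $Y$ let $\kappa \colon \mathrm{Sd}(X\times Y)\to \mathrm{Sd}\,X\times \mathrm{Sd}\,Y$ be the canonical map whose two components are $\mathrm{Sd}(\mathrm{pr}_1)$ and $\mathrm{Sd}(\mathrm{pr}_2)$. A map $f\colon A\to B$ of finite simplicial sets (simplicial sets with finitely many non-degenerate simplices) is called simple if its geometric realization $|f|\colon |A|\to|B|$ has contractible point inverses, i.e. the preimage $|f|^{-1}(b)$ is contractible (in particular non-empty) for each point $b\in|B|$. Proposition. For all integers $m\ge 0$ and $n\ge 0$, the canonical map $$\kappa\colon \mathrm{Sd}(\Delta[m]\times\Delta[n])\longrightarrow \mathrm{Sd}\,\Delta[m]\times \mathrm{Sd}\,\Delta[n]$$ is a simple map of finite simplicial sets. -/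

import Mathlib

universe u

open CategoryTheory MonoidalCategory CartesianMonoidalCategory
open scoped Simplicial

namespace SSet

/-- A map `f : A ⟶ B` of finite simplicial sets is *simple* if its geometric realization has
contractible point inverses. (Contractible spaces are in particular nonempty.) -/
structure IsSimple {A B : SSet.{u}} (f : A ⟶ B) : Prop where
  finite_source : A.Finite
  finite_target : B.Finite
  contractible_fiber : ∀ b : (|B| : TopCat.{u}),
    ContractibleSpace ((SSet.toTop.map f).hom ⁻¹' {b} : Set (|A| : TopCat.{u}))

/-- The canonical map `κ = (Sd pr₁, Sd pr₂) : Sd (X × Y) ⟶ Sd X × Sd Y`, where `Sd` is Kan's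
normal subdivision (the left Kan extension along the Yoneda embedding of the functor sending `[n]`
to the nerve of the poset of nonempty subsets of `[n]`, ordered by inclusion), and where
`⊗` is the cartesian product of simplicial sets. -/
noncomputable def sdProdComparison (X Y : SSet.{u}) :
    SSet.sd.obj (X ⊗ Y) ⟶ SSet.sd.obj X ⊗ SSet.sd.obj Y :=
  lift (SSet.sd.map (fst X Y)) (SSet.sd.map (snd X Y))

end SSet

/-!
The subdivision of the nerve of a partial order `Q` is the nerve of the partial order of nonempty
finite chains of `Q` (`sdNerve`), and both `Δ[n]` and `Δ[m] × Δ[n]` are nerves. For finite `Q`,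
a point of the realization of this subdivision is thus a probability distribution on the chains of
`Q`, supported on a nested family of chains. Superposing the indicator functions of these chains
with the given masses (`layerSum`) yields a function `Q → ℝ` whose superlevel sets are the chains;
this identifies `|Sd (nerve Q)|` with the space of nonnegative functions on `Q` that have maximum
`1` and are supported on a chain (`layerCoord_injective`, `exists_layerCoord_eq`). In these
coordinates a monotone map of partial orders acts by taking maxima over its fibres
(`isGreatest_layerCoord_map`).

A point of the realization of `Sd Δ[m] × Sd Δ[n]` is determined by its two projections
(`eq_of_toTop_map_fst_snd`), which have coordinates `a` on `[m]` and `b` on `[n]`. The fibre of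
the comparison map over it is therefore the space `maxCouplings a b` of nonnegative functions on
`[m] × [n]` that are supported on a chain and have row maxima `a` and column maxima `b`
(`image_prodCoord_fibre`; the coordinates are an embedding, as the realization is compact).

It remains to see that `maxCouplings a b` is contractible (`contractibleSpace_maxCouplings`). If
row and column *sums* were prescribed instead, there would be exactly one such function, the
monotone coupling of the two marginals, and it depends continuously on them. With `h` in
`maxCouplings a b` associate the row and column sums of `x ↦ h x * exp (c * h x)`. For large `c`
this pair lies in a convex set of pairs of marginals in which higher levels carry much more mass
than lower ones (`dominatingMarginals`). Conversely, for a pair in this set a pigeonhole argument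
shows that the monotone coupling has an entry of at least `a i` in row `i`, in a column with
`a i ≤ b j`, and symmetrically for columns, so that truncating it at `min (a i) (b j)` gives an
element of `maxCouplings a b`. The composite sends `h` to the truncation of
`x ↦ h x * exp (c * h x)`, which a truncated straight-line homotopy deforms to `h`. So
`maxCouplings a b` is a homotopy retract of a nonempty convex set.
-/

namespace SdProd

/-! ### Chain-supported mass distributions on products -/

/-- A function is *chain supported* if any two points of its support are comparable. -/
def ChainSupported {α : Type*} [LE α] (w : α → ℝ) : Prop :=
  ∀ x y, w x ≠ 0 → w y ≠ 0 → x ≤ y ∨ y ≤ x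

section Sums

/-- On the support of a chain-supported mass distribution on a product, one of two lower sets, one
for each coordinate, is contained in the other: a point of `A × Bᶜ` and a point of `Aᶜ × B` are
never comparable. -/
lemma ChainSupported.le_or_le {P Q : Type*} [Preorder P] [Preorder Q]
    {w : P × Q → ℝ} (hc : ChainSupported w) {A : P → Prop} {B : Q → Prop}
    (hA : IsLowerSet {i | A i}) (hB : IsLowerSet {j | B j}) :
    (∀ x, w x ≠ 0 → A x.1 → B x.2) ∨ (∀ x, w x ≠ 0 → B x.2 → A x.1) := by
  by_contra! h
  obtain ⟨⟨x, hx, hxA, hxB⟩, y, hy, hyB, hyA⟩ := h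
  rcases hc x y hx hy with h | h
  · exact hxB (hB h.2 hyB)
  · exact hyA (hA h.1 hxA)

variable {P Q : Type*} [Fintype P] [Fintype Q]

lemma sum_ite_le_sum_ite {α : Type*} [Fintype α] {w : α → ℝ} (hw : 0 ≤ w) {A B : α → Prop}
    [DecidablePred A] [DecidablePred B] (h : ∀ x, w x ≠ 0 → A x → B x) :
    (∑ x, if A x then w x else 0) ≤ ∑ x, if B x then w x else 0 := by
  refine Finset.sum_le_sum fun x _ => ?_
  by_cases hx : w x = 0
  · simp [hx]
  · by_cases hA : A x
    · simp [hA, h x hx hA]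
    · rw [if_neg hA]; split_ifs
      · exact hw x
      · exact le_rfl

lemma ChainSupported.sum_and [Preorder P] [Preorder Q] {w : P × Q → ℝ} (hw : 0 ≤ w)
    (hc : ChainSupported w) {A : P → Prop} {B : Q → Prop} [DecidablePred A]
    [DecidablePred B] (hA : IsLowerSet {i | A i}) (hB : IsLowerSet {j | B j}) :
    (∑ x, if A x.1 ∧ B x.2 then w x else 0) =
      min (∑ x, if A x.1 then w x else 0) (∑ x, if B x.2 then w x else 0) := by
  refine le_antisymm (le_min (sum_ite_le_sum_ite hw fun x _ h => h.1)
    (sum_ite_le_sum_ite hw fun x _ h => h.2)) ?_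
  rcases hc.le_or_le hA hB with h | h
  · exact (min_le_left _ _).trans (sum_ite_le_sum_ite hw fun x hx hxA => ⟨hxA, h x hx hxA⟩)
  · exact (min_le_right _ _).trans (sum_ite_le_sum_ite hw fun x hx hxB => ⟨h x hx hxB, hxB⟩)

lemma ChainSupported.sum_or [Preorder P] [Preorder Q] {w : P × Q → ℝ} (hw : 0 ≤ w)
    (hc : ChainSupported w) {A : P → Prop} {B : Q → Prop} [DecidablePred A]
    [DecidablePred B] (hA : IsLowerSet {i | A i}) (hB : IsLowerSet {j | B j}) :
    (∑ x, if A x.1 ∨ B x.2 then w x else 0) =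
      max (∑ x, if A x.1 then w x else 0) (∑ x, if B x.2 then w x else 0) := by
  refine le_antisymm ?_ (max_le (sum_ite_le_sum_ite hw fun x _ h => Or.inl h)
    (sum_ite_le_sum_ite hw fun x _ h => Or.inr h))
  rcases hc.le_or_le hA hB with h | h
  · refine le_trans (sum_ite_le_sum_ite hw fun x hx hxA => ?_) (le_max_right _ _)
    exact hxA.elim (h x hx) id
  · refine le_trans (sum_ite_le_sum_ite hw fun x hx hxA => ?_) (le_max_left _ _)
    exact hxA.elim id (h x hx)

lemma sum_fst_ite (w : P × Q → ℝ) (A : P → Prop) [DecidablePred A] :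
    (∑ i, if A i then ∑ j, w (i, j) else 0) = ∑ x : P × Q, if A x.1 then w x else 0 := by
  rw [Fintype.sum_prod_type]
  refine Finset.sum_congr rfl fun i _ => ?_
  by_cases h : A i <;> simp [h]

lemma sum_snd_ite (w : P × Q → ℝ) (B : Q → Prop) [DecidablePred B] :
    (∑ j, if B j then ∑ i, w (i, j) else 0) = ∑ x : P × Q, if B x.2 then w x else 0 := by
  rw [Fintype.sum_prod_type_right]
  refine Finset.sum_congr rfl fun i _ => ?_
  by_cases h : B i <;> simp [h]

/-- A function on a finite partial order is determined by its sums over principal lower sets. -/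
lemma eq_of_sum_le_eq [PartialOrder P] [DecidableLE P] {w w' : P → ℝ}
    (h : ∀ p, (∑ x, if x ≤ p then w x else 0) = ∑ x, if x ≤ p then w' x else 0) : w = w' := by
  classical
  have key (v : P → ℝ) (p : P) :
      (∑ x, if x ≤ p then v x else 0) = (∑ x, if x < p then v x else 0) + v p := by
    have : ∀ x, (if x ≤ p then v x else 0) =
        (if x < p then v x else 0) + if x = p then v x else 0 := by
      intro x
      rcases eq_or_ne x p with rfl | hx
      · simp
      · simp [hx, le_iff_lt_or_eq]
    simp [this, Finset.sum_add_distrib]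
  funext p
  induction p using WellFoundedLT.induction with
  | ind p ih =>
    have h1 := h p
    rw [key, key] at h1
    have : (∑ x, if x < p then w x else 0) = ∑ x, if x < p then w' x else 0 :=
      Finset.sum_congr rfl fun x _ => by split_ifs with hx; exacts [ih x hx, rfl]
    linarith

/-- A chain-supported mass distribution on a product of finite partial orders is determined by
its two marginals. -/
lemma ChainSupported.eq_of_marginals [PartialOrder P] [PartialOrder Q] {w w' : P × Q → ℝ}
    (hw : 0 ≤ w) (hw' : 0 ≤ w') (hc : ChainSupported w) (hc' : ChainSupported w')
    (h₁ : ∀ i, ∑ j, w (i, j) = ∑ j, w' (i, j)) (h₂ : ∀ j, ∑ i, w (i, j) = ∑ i, w' (i, j)) :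
    w = w' := by
  classical
  refine eq_of_sum_le_eq fun p => ?_
  have e1 := hc.sum_and hw (A := (· ≤ p.1)) (B := (· ≤ p.2)) (isLowerSet_Iic p.1)
    (isLowerSet_Iic p.2)
  have e2 := hc'.sum_and hw' (A := (· ≤ p.1)) (B := (· ≤ p.2)) (isLowerSet_Iic p.1)
    (isLowerSet_Iic p.2)
  rw [← sum_fst_ite w (· ≤ p.1), ← sum_snd_ite w (· ≤ p.2)] at e1
  rw [← sum_fst_ite w' (· ≤ p.1), ← sum_snd_ite w' (· ≤ p.2)] at e2
  simp only [h₁, h₂] at e1 e2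
  simp only [Prod.le_def]
  convert e1.trans e2.symm

end Sums

/-! ### The monotone coupling -/

section MonotoneCoupling

variable {P Q : Type*} [Fintype P] [Fintype Q] [LinearOrder P] [LinearOrder Q]

/-- The monotone coupling of two mass distributions `s` and `t` of the same total mass on finite
linear orders: cut `[0, ∑ s]` into consecutive intervals of lengths `s i`, and likewise into
intervals of lengths `t j`; the mass at `(i, j)` is the length of the overlap of the `i`-th
interval of the first kind with the `j`-th interval of the second kind. -/
noncomputable def monotoneCoupling (s : P → ℝ) (t : Q → ℝ) (x : P × Q) : ℝ :=
  max 0 (min (∑ i, if i ≤ x.1 then s i else 0) (∑ j, if j ≤ x.2 then t j else 0) -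
    max (∑ i, if i < x.1 then s i else 0) (∑ j, if j < x.2 then t j else 0))

lemma continuous_monotoneCoupling :
    Continuous fun p : (P → ℝ) × (Q → ℝ) => monotoneCoupling p.1 p.2 := by
  have h {c : Prop} [Decidable c] {f : (P → ℝ) × (Q → ℝ) → ℝ} (hf : Continuous f) :
      Continuous fun p => if c then f p else 0 := by
    split_ifs
    · exact hf
    · exact continuous_const
  refine continuous_pi fun x => ?_
  unfold monotoneCoupling
  refine continuous_const.max (Continuous.sub (Continuous.min ?_ ?_) (Continuous.max ?_ ?_)) <;>
  exact continuous_finsetSum _ fun i _ => h (by fun_prop)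

lemma monotoneCoupling_nonneg (s : P → ℝ) (t : Q → ℝ) : 0 ≤ monotoneCoupling s t :=
  fun _ => le_max_left _ _

lemma sum_ite_le_eq (s : P → ℝ) (i : P) :
    (∑ k, if k ≤ i then s k else 0) = (∑ k, if k < i then s k else 0) + s i := by
  have : ∀ x, (if x ≤ i then s x else 0) =
      (if x < i then s x else 0) + if x = i then s x else 0 := by
    intro x
    rcases eq_or_ne x i with rfl | hx
    · simp
    · simp [hx, le_iff_lt_or_eq]
  simp [this, Finset.sum_add_distrib]

lemma chainSupported_monotoneCoupling {s : P → ℝ} {t : Q → ℝ} (hs : 0 ≤ s) (ht : 0 ≤ t) :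
    ChainSupported (monotoneCoupling s t) := by
  have pos {x : P × Q} (hx : monotoneCoupling s t x ≠ 0) :
      max (∑ i, if i < x.1 then s i else 0) (∑ j, if j < x.2 then t j else 0) <
      min (∑ i, if i ≤ x.1 then s i else 0) (∑ j, if j ≤ x.2 then t j else 0) := by
    by_contra! h
    exact hx (max_eq_left (by linarith))
  -- an inversion would put one overlap both strictly before and strictly after the other
  have key {x y : P × Q} (hx : monotoneCoupling s t x ≠ 0) (hy : monotoneCoupling s t y ≠ 0)
      (h1 : x.1 < y.1) (h2 : y.2 < x.2) : False := by
    have a := pos hx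
    have b := pos hy
    simp only [max_lt_iff, lt_min_iff] at a b
    have c : (∑ j, if j ≤ y.2 then t j else 0) ≤ ∑ j, if j < x.2 then t j else 0 :=
      sum_ite_le_sum_ite ht fun j _ hj => lt_of_le_of_lt hj h2
    have d : (∑ j, if j ≤ x.1 then s j else 0) ≤ ∑ j, if j < y.1 then s j else 0 :=
      sum_ite_le_sum_ite hs fun j _ hj => lt_of_le_of_lt hj h1
    linarith [a.2.1, b.1.2]
  intro x y hx hy
  rcases lt_trichotomy x.1 y.1 with h | h | h
  · exact Or.inl ⟨h.le, not_lt.1 fun h' => key hx hy h h'⟩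
  · exact (le_total x.2 y.2).imp (fun h' => ⟨h.le, h'⟩) (fun h' => ⟨h.ge, h'⟩)
  · exact Or.inr ⟨h.le, not_lt.1 fun h' => key hy hx h h'⟩

lemma monotoneCoupling_le_right (s : P → ℝ) {t : Q → ℝ} (ht : 0 ≤ t) (x : P × Q) :
    monotoneCoupling s t x ≤ t x.2 := by
  refine max_le (ht _) ?_
  have h := sum_ite_le_eq t x.2
  have h1 := min_le_right (∑ i, if i ≤ x.1 then s i else 0) (∑ j, if j ≤ x.2 then t j else 0)
  have h2 := le_max_right (∑ i, if i < x.1 then s i else 0) (∑ j, if j < x.2 then t j else 0)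
  linarith

lemma monotoneCoupling_swap (s : P → ℝ) (t : Q → ℝ) (x : P × Q) :
    monotoneCoupling t s x.swap = monotoneCoupling s t x := by
  simp only [monotoneCoupling, Prod.fst_swap, Prod.snd_swap]
  rw [min_comm, max_comm (∑ i, if i < x.2 then t i else 0)]

/-- Telescoping of a function along the partial sums of `t`, for finite linear orders. -/
lemma sum_telescope (t : Q → ℝ) (ψ : ℝ → ℝ) :
    ∑ j, (ψ (∑ k, if k ≤ j then t k else 0) - ψ (∑ k, if k < j then t k else 0)) =
      ψ (∑ j, t j) - ψ 0 := by
  have key (S : Finset Q) : ∑ j ∈ S, (ψ (∑ k ∈ S, if k ≤ j then t k else 0) -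
      ψ (∑ k ∈ S, if k < j then t k else 0)) = ψ (∑ j ∈ S, t j) - ψ 0 := by
    induction S using Finset.induction_on_max with
    | empty => simp
    | insert m S hm ih =>
      have hmS : m ∉ S := fun h => lt_irrefl _ (hm m h)
      rw [Finset.sum_insert hmS]
      have e1 : (∑ k ∈ insert m S, if k ≤ m then t k else 0) = t m + ∑ j ∈ S, t j := by
        rw [Finset.sum_insert hmS, if_pos le_rfl]
        congr 1
        exact Finset.sum_congr rfl fun k hk => if_pos (hm k hk).le
      have e2 : (∑ k ∈ insert m S, if k < m then t k else 0) = ∑ j ∈ S, t j := by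
        rw [Finset.sum_insert hmS, if_neg (lt_irrefl _), zero_add]
        exact Finset.sum_congr rfl fun k hk => if_pos (hm k hk)
      have e3 : ∑ j ∈ S, (ψ (∑ k ∈ insert m S, if k ≤ j then t k else 0) -
          ψ (∑ k ∈ insert m S, if k < j then t k else 0)) = ψ (∑ j ∈ S, t j) - ψ 0 := by
        rw [← ih]
        refine Finset.sum_congr rfl fun j hj => ?_
        rw [Finset.sum_insert hmS, Finset.sum_insert hmS, if_neg (hm j hj).not_ge,
          if_neg (hm j hj).not_gt, zero_add, zero_add]
      rw [e1, e2, e3, Finset.sum_insert hmS]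
      ring
  exact key Finset.univ

/-- The overlaps in row `i` cover the `i`-th interval, so that the row carries at least the mass
`s i`. -/
lemma le_sum_monotoneCoupling {s : P → ℝ} {t : Q → ℝ} (hs : 0 ≤ s) (ht : 0 ≤ t)
    (hst : ∑ i, s i = ∑ j, t j) (i : P) : s i ≤ ∑ j, monotoneCoupling s t (i, j) := by
  set lo := ∑ k, if k < i then s k else 0 with hlo
  set hi := ∑ k, if k ≤ i then s k else 0 with hhi
  have hlohi : hi = lo + s i := sum_ite_le_eq s i
  have hlo0 : 0 ≤ lo := Finset.sum_nonneg fun k _ => by split_ifs; exacts [hs k, le_rfl]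
  have hhiT : hi ≤ ∑ j, t j := by
    rw [← hst]
    exact Finset.sum_le_sum fun k _ => by split_ifs; exacts [le_rfl, hs k]
  -- clamp the partial sums of `t` to the `i`-th interval
  have tel := sum_telescope t (fun τ => min (max τ lo) hi)
  have hsi : 0 ≤ s i := hs i
  rw [max_eq_left (by linarith : lo ≤ ∑ j, t j), min_eq_right hhiT, max_eq_right hlo0,
    min_eq_left (by linarith)] at tel
  have : s i = hi - lo := by linarith
  rw [this, ← tel]
  refine Finset.sum_le_sum fun j _ => ?_
  have hj := sum_ite_le_eq t j
  have htj : 0 ≤ t j := ht j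
  simp only [monotoneCoupling]
  rw [← hlo, ← hhi]
  generalize (∑ k, if k ≤ j then t k else 0) = x at *
  generalize (∑ k, if k < j then t k else 0) = y at *
  have hyx : y ≤ x := by linarith
  rcases le_total x lo with h1 | h1
  · rw [max_eq_right h1, max_eq_right (hyx.trans h1), sub_self]
    exact le_max_left _ _
  rcases le_total hi y with h2 | h2
  · rw [max_eq_left h1, max_eq_left (by linarith), min_eq_right h2, min_eq_right (by linarith),
      sub_self]
    exact le_max_left _ _
  · rw [max_eq_left h1, min_eq_left (max_le h2 (by linarith)), min_comm hi x, max_comm lo y]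
    exact le_max_right _ _

/-- A chain-supported mass distribution is the monotone coupling of its marginals. -/
lemma ChainSupported.monotoneCoupling_marginals {w : P × Q → ℝ} (hw : 0 ≤ w)
    (hc : ChainSupported w) :
    monotoneCoupling (fun i => ∑ j, w (i, j)) (fun j => ∑ i, w (i, j)) = w := by
  funext x
  simp only [monotoneCoupling, sum_fst_ite, sum_snd_ite]
  have e1 := hc.sum_and hw (A := (· ≤ x.1)) (B := (· ≤ x.2)) (isLowerSet_Iic x.1)
    (isLowerSet_Iic x.2)
  have e2 := hc.sum_or hw (A := (· < x.1)) (B := (· < x.2)) (isLowerSet_Iio x.1)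
    (isLowerSet_Iio x.2)
  rw [← e1, ← e2]
  -- the overlap is `w x` minus the mass of the points incomparable with `x`
  have hsum : (∑ y : P × Q, if y.1 ≤ x.1 ∧ y.2 ≤ x.2 then w y else 0) -
      (∑ y : P × Q, if y.1 < x.1 ∨ y.2 < x.2 then w y else 0) =
      w x - ∑ y : P × Q, if (y.1 < x.1 ∧ x.2 < y.2) ∨ (x.1 < y.1 ∧ y.2 < x.2) then w y else 0 := by
    have hx : w x = ∑ y, if y = x then w y else 0 := by simp
    rw [hx, ← Finset.sum_sub_distrib, ← Finset.sum_sub_distrib]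
    refine Finset.sum_congr rfl fun y _ => ?_
    rcases lt_trichotomy y.1 x.1 with h1 | h1 | h1 <;>
    rcases lt_trichotomy y.2 x.2 with h2 | h2 | h2 <;>
    grind [Prod.ext_iff]
  rw [hsum]
  by_cases hx : w x = 0
  · rw [hx]
    refine max_eq_left ?_
    have : 0 ≤ ∑ y : P × Q,
        if (y.1 < x.1 ∧ x.2 < y.2) ∨ (x.1 < y.1 ∧ y.2 < x.2) then w y else 0 :=
      Finset.sum_nonneg fun y _ => by split_ifs; exacts [hw y, le_rfl]
    linarith
  · have : (∑ y : P × Q,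
        if (y.1 < x.1 ∧ x.2 < y.2) ∨ (x.1 < y.1 ∧ y.2 < x.2) then w y else 0) = 0 := by
      refine Finset.sum_eq_zero fun y _ => ?_
      by_cases hy : w y = 0
      · simp [hy]
      · refine if_neg ?_
        rcases hc x y hx hy with h | h
        · rintro (⟨h1, -⟩ | ⟨-, h1⟩)
          exacts [h1.not_ge h.1, h1.not_ge h.2]
        · rintro (⟨-, h1⟩ | ⟨h1, -⟩)
          exacts [h1.not_ge h.2, h1.not_ge h.1]
    rw [this, sub_zero]
    exact max_eq_right (hw x)

end MonotoneCoupling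

/-! ### Functions with prescribed row and column maxima -/

section Contractible

variable {P Q : Type*}

/-- The nonnegative chain-supported functions on `P × Q` with row maxima `a` and column
maxima `b`. -/
def maxCouplings [LE P] [LE Q] (a : P → ℝ) (b : Q → ℝ) : Set (P × Q → ℝ) :=
  {h | 0 ≤ h ∧ ChainSupported h ∧ (∀ i, IsGreatest (Set.range fun j => h (i, j)) (a i)) ∧
    ∀ j, IsGreatest (Set.range fun i => h (i, j)) (b j)}

/-- The mass `s i` exceeds, by at least `K * a i`, the total `t`-mass of the indices whose level
`b j` is below the level `a i`. -/
def Dominates [Fintype Q] (K : ℝ) (a : P → ℝ) (b : Q → ℝ) (s : P → ℝ) (t : Q → ℝ) : Prop :=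
  ∀ i, (∑ j, if b j < a i then t j else 0) + K * a i ≤ s i

/-- Pairs of mass distributions of equal total mass in which higher levels carry much more mass
than lower ones, so that every row and every column has a large entry of the monotone coupling
at a place where it may attain its prescribed maximum. -/
def dominatingMarginals [Fintype P] [Fintype Q] (K : ℝ) (a : P → ℝ) (b : Q → ℝ) :
    Set ((P → ℝ) × (Q → ℝ)) :=
  {p | 0 ≤ p.1 ∧ 0 ≤ p.2 ∧ ∑ i, p.1 i = ∑ j, p.2 j ∧ Dominates K a b p.1 p.2 ∧
    Dominates K b a p.2 p.1}

lemma Dominates.convex_combination [Fintype Q] {K : ℝ} {a : P → ℝ} {b : Q → ℝ} {s s' : P → ℝ}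
    {t t' : Q → ℝ} (h : Dominates K a b s t) (h' : Dominates K a b s' t') {x y : ℝ} (hx : 0 ≤ x)
    (hy : 0 ≤ y) (hxy : x + y = 1) : Dominates K a b (x • s + y • s') (x • t + y • t') := by
  intro i
  have e : (∑ j, if b j < a i then (x • t + y • t') j else 0) =
      x * (∑ j, if b j < a i then t j else 0) + y * ∑ j, if b j < a i then t' j else 0 := by
    rw [Finset.mul_sum, Finset.mul_sum, ← Finset.sum_add_distrib]
    exact Finset.sum_congr rfl fun j _ => by split_ifs <;> simp
  have h1 := mul_le_mul_of_nonneg_left (h i) hx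
  have h2 := mul_le_mul_of_nonneg_left (h' i) hy
  have h3 : K * a i = x * (K * a i) + y * (K * a i) := by rw [← add_mul, hxy, one_mul]
  rw [e, h3]
  simp only [Pi.add_apply, Pi.smul_apply, smul_eq_mul]
  linarith

lemma convex_dominatingMarginals [Fintype P] [Fintype Q] (K : ℝ) (a : P → ℝ) (b : Q → ℝ) :
    Convex ℝ (dominatingMarginals K a b) := by
  rintro p ⟨h1, h2, h3, h4, h5⟩ q ⟨k1, k2, k3, k4, k5⟩ x y hx hy hxy
  refine ⟨?_, ?_, ?_, h4.convex_combination k4 hx hy hxy, h5.convex_combination k5 hx hy hxy⟩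
  · exact add_nonneg (smul_nonneg hx h1) (smul_nonneg hy k1)
  · exact add_nonneg (smul_nonneg hx h2) (smul_nonneg hy k2)
  · simp [Finset.sum_add_distrib, ← Finset.mul_sum, h3, k3]

/-- Row `i` of the monotone coupling carries at least the mass `s i`. At most `∑ t j` of it lies in
the columns with `b j < a i`; the remaining mass `K * a i` is distributed over at most `K`
columns, so one of them receives at least `a i`. -/
lemma Dominates.exists_le_monotoneCoupling [Fintype P] [Fintype Q] [LinearOrder P]
    [LinearOrder Q] {K : ℝ} {a : P → ℝ} {b : Q → ℝ} {s : P → ℝ} {t : Q → ℝ}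
    (h : Dominates K a b s t) (hs : 0 ≤ s) (ht : 0 ≤ t) (hst : ∑ i, s i = ∑ j, t j)
    (hK : (Fintype.card Q : ℝ) ≤ K) {i : P} (hi : ∃ j, a i ≤ b j) :
    ∃ j, a i ≤ b j ∧ a i ≤ monotoneCoupling s t (i, j) := by
  by_contra! hlt
  obtain ⟨j₀, hj₀⟩ := hi
  have hpos : 0 < a i := (monotoneCoupling_nonneg s t _).trans_lt (hlt j₀ hj₀)
  have h1 : ∑ j, monotoneCoupling s t (i, j) <
      ∑ j, ((if b j < a i then t j else 0) + a i) := by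
    refine Finset.sum_lt_sum (fun j _ => ?_) ⟨j₀, Finset.mem_univ _, ?_⟩
    · split_ifs with hj
      · linarith [monotoneCoupling_le_right s ht (i, j)]
      · linarith [hlt j (not_lt.1 hj)]
    · rw [if_neg (not_lt.2 hj₀), zero_add]
      exact hlt j₀ hj₀
  rw [Finset.sum_add_distrib, Finset.sum_const, Finset.card_univ, nsmul_eq_mul] at h1
  have h2 := le_sum_monotoneCoupling hs ht hst i
  have h3 := mul_le_mul_of_nonneg_right hK hpos.le
  linarith [h i]

/-- Truncating at `min (a i) (b j)` turns a chain-supported function that is large enough in every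
row and column into one with the prescribed maxima. -/
lemma min_mem_maxCouplings [LE P] [LE Q] {a : P → ℝ} {b : Q → ℝ} (ha : 0 ≤ a) (hb : 0 ≤ b)
    {v : P × Q → ℝ} (hv : 0 ≤ v) (hc : ChainSupported v)
    (h₁ : ∀ i, ∃ j, a i ≤ b j ∧ a i ≤ v (i, j)) (h₂ : ∀ j, ∃ i, b j ≤ a i ∧ b j ≤ v (i, j)) :
    (fun x => min (min (a x.1) (b x.2)) (v x)) ∈ maxCouplings a b := by
  refine ⟨fun x => le_min (le_min (ha _) (hb _)) (hv _), ?_, fun i => ⟨?_, ?_⟩, fun j => ⟨?_, ?_⟩⟩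
  · have key (x : P × Q) (hx : min (min (a x.1) (b x.2)) (v x) ≠ 0) : v x ≠ 0 := by
      rintro h
      rw [h] at hx
      exact hx (min_eq_right (le_min (ha _) (hb _)))
    exact fun x y hx hy => hc x y (key x hx) (key y hy)
  · obtain ⟨j, h, h'⟩ := h₁ i
    exact ⟨j, by simp [h, h']⟩
  · rintro _ ⟨j, rfl⟩
    exact (min_le_left _ _).trans (min_le_left _ _)
  · obtain ⟨i, h, h'⟩ := h₂ j
    exact ⟨i, by simp [h, h']⟩
  · rintro _ ⟨i, rfl⟩
    exact (min_le_left _ _).trans (min_le_right _ _)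

lemma maxCouplings_le [LE P] [LE Q] {a : P → ℝ} {b : Q → ℝ} {h : P × Q → ℝ}
    (hh : h ∈ maxCouplings a b) (x : P × Q) : h x ≤ min (a x.1) (b x.2) :=
  le_min ((hh.2.2.1 x.1).2 ⟨x.2, rfl⟩) ((hh.2.2.2 x.2).2 ⟨x.1, rfl⟩)

lemma min_mem_maxCouplings_of_le [LE P] [LE Q] {a : P → ℝ} {b : Q → ℝ} (ha : 0 ≤ a) (hb : 0 ≤ b)
    {h v : P × Q → ℝ} (hh : h ∈ maxCouplings a b) (hv : h ≤ v) (hv0 : ∀ x, h x = 0 → v x = 0) :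
    (fun x => min (min (a x.1) (b x.2)) (v x)) ∈ maxCouplings a b := by
  refine min_mem_maxCouplings ha hb (hh.1.trans hv)
    (fun x y hx hy => hh.2.1 x y (mt (hv0 x) hx) (mt (hv0 y) hy)) (fun i => ?_) (fun j => ?_)
  · obtain ⟨j, hj⟩ := (hh.2.2.1 i).1
    dsimp only at hj
    exact ⟨j, hj ▸ (maxCouplings_le hh (i, j)).trans (min_le_right _ _), hj ▸ hv _⟩
  · obtain ⟨i, hi⟩ := (hh.2.2.2 j).1
    dsimp only at hi
    exact ⟨i, hi ▸ (maxCouplings_le hh (i, j)).trans (min_le_left _ _), hi ▸ hv _⟩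

/-- The rescaling `x ↦ x * exp (c * x)`; for large `c` it spreads finitely many given levels
arbitrarily far apart. -/
noncomputable def spread (c x : ℝ) : ℝ := x * Real.exp (c * x)

lemma spread_nonneg (c : ℝ) {x : ℝ} (hx : 0 ≤ x) : 0 ≤ spread c x :=
  mul_nonneg hx (Real.exp_pos _).le

lemma le_spread {c x : ℝ} (hc : 0 ≤ c) (hx : 0 ≤ x) : x ≤ spread c x :=
  le_mul_of_one_le_right hx (Real.one_le_exp (mul_nonneg hc hx))

lemma spread_mono {c x y : ℝ} (hc : 0 ≤ c) (hx : 0 ≤ x) (hxy : x ≤ y) :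
    spread c x ≤ spread c y := by
  have := hx.trans hxy
  unfold spread
  gcongr

@[simp]
lemma spread_zero (c : ℝ) : spread c 0 = 0 := by simp [spread]

lemma spread_ne_zero {c x : ℝ} : spread c x ≠ 0 ↔ x ≠ 0 := by simp [spread]

lemma continuous_spread (c : ℝ) : Continuous (spread c) := by
  unfold spread
  fun_prop

lemma eventually_mul_spread_le (M : ℝ) {x y : ℝ} (hy : 0 ≤ y) (hxy : y < x) :
    ∀ᶠ c in Filter.atTop, M * spread c y ≤ spread c x := by
  have h : Filter.Tendsto (fun c => Real.exp (c * (x - y))) Filter.atTop Filter.atTop :=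
    Real.tendsto_exp_atTop.comp (Filter.tendsto_id.atTop_mul_const (sub_pos.2 hxy))
  filter_upwards [h.eventually_ge_atTop M] with c hc
  unfold spread
  calc M * (y * Real.exp (c * y)) ≤ Real.exp (c * (x - y)) * (y * Real.exp (c * y)) := by gcongr
    _ = y * Real.exp (c * x) := by
      rw [mul_left_comm, ← Real.exp_add]
      ring_nf
    _ ≤ x * Real.exp (c * x) := by gcongr

lemma eventually_mul_le_spread (M : ℝ) {x : ℝ} (hx : 0 ≤ x) :
    ∀ᶠ c in Filter.atTop, M * x ≤ spread c x := by
  rcases hx.eq_or_lt with rfl | hx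
  · simp
  have h : Filter.Tendsto (fun c => Real.exp (c * x)) Filter.atTop Filter.atTop :=
    Real.tendsto_exp_atTop.comp (Filter.tendsto_id.atTop_mul_const hx)
  filter_upwards [h.eventually_ge_atTop M] with c hc
  rw [spread, mul_comm]
  gcongr

lemma eventually_spread_gap [Finite P] [Finite Q] (M : ℝ) {a : P → ℝ} {b : Q → ℝ} (ha : 0 ≤ a)
    (hb : 0 ≤ b) :
    ∀ᶠ c in Filter.atTop, ∀ i, M * a i ≤ spread c (a i) ∧
      ∀ j, b j < a i → M * spread c (b j) ≤ spread c (a i) := by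
  rw [Filter.eventually_all]
  intro i
  refine (eventually_mul_le_spread M (ha i)).and ?_
  rw [Filter.eventually_all]
  intro j
  rw [Filter.eventually_imp_distrib_left]
  exact eventually_mul_spread_le M (hb j)

/-- If the levels are spread far apart, marginals comparable with the spread levels satisfy the
domination condition: half of `s i` pays for the lower columns and half for the margin. -/
lemma dominates_of_spread_gap [Fintype P] [Fintype Q] [Nonempty P] [Nonempty Q] {a : P → ℝ}
    {b : Q → ℝ} {c : ℝ} (ha : 0 ≤ a)
    (hgap : ∀ i, 2 * (Fintype.card P * Fintype.card Q : ℝ) * a i ≤ spread c (a i) ∧ ∀ j,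
      b j < a i → 2 * (Fintype.card P * Fintype.card Q : ℝ) * spread c (b j) ≤ spread c (a i))
    {s : P → ℝ} {t : Q → ℝ} (hs : ∀ i, spread c (a i) ≤ s i)
    (ht : ∀ i j, b j < a i → t j ≤ Fintype.card P * spread c (b j)) :
    Dominates (Fintype.card P * Fintype.card Q) a b s t := by
  intro i
  have hP : (0 : ℝ) < Fintype.card P := by exact_mod_cast Fintype.card_pos
  have hQ : (0 : ℝ) < Fintype.card Q := by exact_mod_cast Fintype.card_pos
  have h0 : 0 ≤ spread c (a i) := spread_nonneg c (ha i)
  have h1 : (∑ j, if b j < a i then t j else 0) ≤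
      ∑ _j : Q, spread c (a i) / (2 * Fintype.card Q) := by
    refine Finset.sum_le_sum fun j _ => ?_
    split_ifs with hj
    · refine (ht i j hj).trans ?_
      rw [le_div_iff₀ (by positivity)]
      linarith [(hgap i).2 j hj]
    · positivity
  rw [Finset.sum_const, Finset.card_univ, nsmul_eq_mul] at h1
  have h2 : (Fintype.card Q : ℝ) * (spread c (a i) / (2 * Fintype.card Q)) =
      spread c (a i) / 2 := by
    field_simp
  linarith [(hgap i).1, hs i]

lemma nonempty_dominatingMarginals [Fintype P] [Fintype Q] [Nonempty P] [Nonempty Q] {a : P → ℝ}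
    {b : Q → ℝ} {c : ℝ}
    (ha : 0 ≤ a) (hb : 0 ≤ b) (ha1 : IsGreatest (Set.range a) 1)
    (hb1 : IsGreatest (Set.range b) 1) {K : ℝ}
    (h₁ : ∀ (s : P → ℝ) (t : Q → ℝ), (∀ i, spread c (a i) ≤ s i) →
      (∀ j, b j < 1 → t j = spread c (b j)) → Dominates K a b s t)
    (h₂ : ∀ (s : P → ℝ) (t : Q → ℝ), (∀ j, spread c (b j) ≤ t j) →
      (∀ i, a i < 1 → s i = spread c (a i)) → Dominates K b a t s) :
    (dominatingMarginals K a b).Nonempty := by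
  classical
  obtain ⟨i₀, hi₀⟩ := ha1.1
  obtain ⟨j₀, hj₀⟩ := hb1.1
  have hA (i) : 0 ≤ spread c (a i) := spread_nonneg c (ha i)
  have hB (j) : 0 ≤ spread c (b j) := spread_nonneg c (hb j)
  have hSA : 0 ≤ ∑ i, spread c (a i) := Finset.sum_nonneg fun i _ => hA i
  have hSB : 0 ≤ ∑ j, spread c (b j) := Finset.sum_nonneg fun j _ => hB j
  -- balance the total masses by adding mass at the top level, where no constraint is affected
  let s : P → ℝ := fun i => spread c (a i) + if i = i₀ then ∑ j, spread c (b j) else 0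
  let t : Q → ℝ := fun j => spread c (b j) + if j = j₀ then ∑ i, spread c (a i) else 0
  have hs (i) : spread c (a i) ≤ s i := by
    simp only [s]; split_ifs <;> linarith
  have ht (j) : spread c (b j) ≤ t j := by
    simp only [t]; split_ifs <;> linarith
  refine ⟨(s, t), fun i => (hA i).trans (hs i), fun j => (hB j).trans (ht j), ?_,
    h₁ s t hs fun j hj => ?_, h₂ s t ht fun i hi => ?_⟩
  · simp [s, t, Finset.sum_add_distrib, add_comm]
  · have : j ≠ j₀ := by rintro rfl; exact hj.ne hj₀
    simp [t, this]
  · have : i ≠ i₀ := by rintro rfl; exact hi.ne hi₀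
    simp [s, this]

/-- The space of chain-supported functions with prescribed row and column maxima is contractible:
it is a homotopy retract of a convex set of pairs of marginals, by means of the monotone
coupling. -/
theorem contractibleSpace_maxCouplings [Fintype P] [Fintype Q] [LinearOrder P] [LinearOrder Q]
    {a : P → ℝ} {b : Q → ℝ}
    (ha : 0 ≤ a) (hb : 0 ≤ b) (ha1 : IsGreatest (Set.range a) 1)
    (hb1 : IsGreatest (Set.range b) 1) : ContractibleSpace (maxCouplings a b) := by
  obtain ⟨i₀, hi₀⟩ := ha1.1
  obtain ⟨j₀, hj₀⟩ := hb1.1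
  have : Nonempty P := ⟨i₀⟩
  have : Nonempty Q := ⟨j₀⟩
  have hai (i) : a i ≤ 1 := ha1.2 ⟨i, rfl⟩
  have hbj (j) : b j ≤ 1 := hb1.2 ⟨j, rfl⟩
  have hP : (1 : ℝ) ≤ Fintype.card P := by exact_mod_cast Fintype.card_pos
  have hQ : (1 : ℝ) ≤ Fintype.card Q := by exact_mod_cast Fintype.card_pos
  set K : ℝ := Fintype.card P * Fintype.card Q with hK
  have hKP : (Fintype.card P : ℝ) ≤ K := le_mul_of_one_le_right (by linarith) hQ
  have hKQ : (Fintype.card Q : ℝ) ≤ K := le_mul_of_one_le_left (by linarith) hP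
  obtain ⟨c, ⟨hgap, hgap'⟩, hc⟩ := (((eventually_spread_gap (2 * K) ha hb).and
    (eventually_spread_gap (2 * K) hb ha)).and (Filter.eventually_ge_atTop 0)).exists
  have dom {s : P → ℝ} {t : Q → ℝ} (hs : ∀ i, spread c (a i) ≤ s i)
      (ht : ∀ i j, b j < a i → t j ≤ Fintype.card P * spread c (b j)) : Dominates K a b s t :=
    dominates_of_spread_gap ha hgap hs ht
  have dom' {s : P → ℝ} {t : Q → ℝ} (ht : ∀ j, spread c (b j) ≤ t j)
      (hs : ∀ j i, a i < b j → s i ≤ Fintype.card Q * spread c (a i)) : Dominates K b a t s := by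
    rw [hK, mul_comm (Fintype.card P : ℝ)] at hgap' ⊢
    exact dominates_of_spread_gap hb hgap' ht hs
  have hne : (dominatingMarginals K a b).Nonempty := by
    refine nonempty_dominatingMarginals ha hb ha1 hb1 (c := c)
      (fun s t hs ht => dom hs fun i j hij => ?_) (fun s t ht hs => dom' ht fun j i hij => ?_)
    · rw [ht j (hij.trans_le (hai i))]
      exact le_mul_of_one_le_left (spread_nonneg c (hb j)) hP
    · rw [hs i (hij.trans_le (hbj j))]
      exact le_mul_of_one_le_left (spread_nonneg c (ha i)) hQ
  have : ContractibleSpace (dominatingMarginals K a b) :=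
    (convex_dominatingMarginals K a b).contractibleSpace hne
  -- from couplings to marginals
  have hσ (h : P × Q → ℝ) (hh : h ∈ maxCouplings a b) :
      ((fun i => ∑ j, spread c (h (i, j)), fun j => ∑ i, spread c (h (i, j))) :
        (P → ℝ) × (Q → ℝ)) ∈ dominatingMarginals K a b := by
    have h0 (x) : 0 ≤ spread c (h x) := spread_nonneg c (hh.1 x)
    refine ⟨fun i => Finset.sum_nonneg fun j _ => h0 _, fun i => Finset.sum_nonneg fun j _ => h0 _,
      Finset.sum_comm, dom (fun i => ?_) (fun i j _ => ?_), dom' (fun j => ?_) (fun j i _ => ?_)⟩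
    · obtain ⟨j, hj⟩ := (hh.2.2.1 i).1
      rw [← hj]
      exact Finset.single_le_sum (f := fun j => spread c (h (i, j))) (fun j _ => h0 _)
        (Finset.mem_univ j)
    · rw [← nsmul_eq_mul, ← Finset.card_univ]
      exact Finset.sum_le_card_nsmul _ _ _ fun i _ => spread_mono hc (hh.1 _)
        ((maxCouplings_le hh (i, j)).trans (min_le_right _ _))
    · obtain ⟨i, hi⟩ := (hh.2.2.2 j).1
      rw [← hi]
      exact Finset.single_le_sum (f := fun i => spread c (h (i, j))) (fun j _ => h0 _)
        (Finset.mem_univ i)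
    · rw [← nsmul_eq_mul, ← Finset.card_univ]
      exact Finset.sum_le_card_nsmul _ _ _ fun j _ => spread_mono hc (hh.1 _)
        ((maxCouplings_le hh (i, j)).trans (min_le_left _ _))
  let σ : C(maxCouplings a b, dominatingMarginals K a b) :=
    ⟨fun h => ⟨_, hσ h.1 h.2⟩, by
      have h1 (x : P × Q) : Continuous fun h : maxCouplings a b => spread c (h.1 x) :=
        (continuous_spread c).comp ((continuous_apply x).comp continuous_subtype_val)
      exact Continuous.subtype_mk (Continuous.prodMk
        (continuous_pi fun i => continuous_finsetSum _ fun j _ => h1 (i, j))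
        (continuous_pi fun j => continuous_finsetSum _ fun i _ => h1 (i, j))) _⟩
  -- from marginals to couplings
  have hρ (p : (P → ℝ) × (Q → ℝ)) (hp : p ∈ dominatingMarginals K a b) :
      (fun x => min (min (a x.1) (b x.2)) (monotoneCoupling p.1 p.2 x)) ∈ maxCouplings a b := by
    obtain ⟨h1, h2, h3, h4, h5⟩ := hp
    refine min_mem_maxCouplings ha hb (monotoneCoupling_nonneg _ _)
      (chainSupported_monotoneCoupling h1 h2) (fun i => ?_) (fun j => ?_)
    · exact h4.exists_le_monotoneCoupling h1 h2 h3 hKQ ⟨j₀, by rw [hj₀]; exact hai i⟩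
    · obtain ⟨i, hi, hi'⟩ := h5.exists_le_monotoneCoupling h2 h1 h3.symm hKP (i := j)
        ⟨i₀, by rw [hi₀]; exact hbj j⟩
      exact ⟨i, hi, hi'.trans_eq (monotoneCoupling_swap p.1 p.2 (i, j))⟩
  let ρ : C(dominatingMarginals K a b, maxCouplings a b) :=
    ⟨fun p => ⟨_, hρ p.1 p.2⟩, by
      refine Continuous.subtype_mk (continuous_pi fun x => ?_) _
      have := (continuous_apply x).comp (continuous_monotoneCoupling (P := P) (Q := Q))
      exact continuous_const.min (this.comp continuous_subtype_val)⟩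
  have hρσ (h : maxCouplings a b) (x : P × Q) :
      (ρ (σ h)).1 x = min (min (a x.1) (b x.2)) (spread c (h.1 x)) := by
    have h1 : ChainSupported (fun x => spread c (h.1 x)) := fun x y hx hy =>
      h.2.2.1 x y (spread_ne_zero.1 hx) (spread_ne_zero.1 hy)
    have h2 := h1.monotoneCoupling_marginals fun x => spread_nonneg c (h.2.1 x)
    exact congrArg (min _) (congrFun h2 x)
  -- the composite is homotopic to the identity through truncated rescalings
  have hH (τ : unitInterval) (h : P × Q → ℝ) (hh : h ∈ maxCouplings a b) :
      (fun x => min (min (a x.1) (b x.2)) ((1 - τ.1) * spread c (h x) + τ.1 * h x)) ∈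
        maxCouplings a b := by
    refine min_mem_maxCouplings_of_le ha hb hh (fun x => ?_) (fun x hx => by simp [hx])
    have := le_spread hc (hh.1 x)
    nlinarith [τ.2.1, τ.2.2]
  have hom : (ρ.comp σ).Homotopic (ContinuousMap.id _) := by
    refine ⟨⟨⟨fun q => ⟨_, hH q.1 q.2.1 q.2.2⟩, ?_⟩, fun h => ?_, fun h => ?_⟩⟩
    · refine Continuous.subtype_mk (continuous_pi fun x => ?_) _
      have h1 : Continuous fun q : unitInterval × maxCouplings a b => q.2.1 x :=
        (continuous_apply x).comp (continuous_subtype_val.comp continuous_snd)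
      have h2 := (continuous_spread c).comp h1
      have h3 : Continuous fun q : unitInterval × maxCouplings a b => q.1.1 :=
        continuous_subtype_val.comp continuous_fst
      exact continuous_const.min (((continuous_const.sub h3).mul h2).add (h3.mul h1))
    · refine Subtype.ext (funext fun x => ?_)
      simpa using (hρσ h x).symm
    · refine Subtype.ext (funext fun x => ?_)
      simpa using maxCouplings_le h.2 x
  rw [contractible_iff_id_nullhomotopic]
  obtain ⟨z, hz⟩ := id_nullhomotopic (dominatingMarginals K a b)
  refine ⟨ρ z, hom.symm.trans ?_⟩
  have h1 := (ContinuousMap.Homotopic.refl ρ).comp (hz.comp (ContinuousMap.Homotopic.refl σ))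
  exact h1

end Contractible

/-! ### Mass distributions on chains and their layer sums -/

section Layers

open PartialOrder

instance {Q : Type*} [PartialOrder Q] [Finite Q] : Finite (NonemptyFiniteChains Q) :=
  Finite.of_injective NonemptyFiniteChains.finset fun _ _ => NonemptyFiniteChains.ext

noncomputable instance {Q : Type*} [PartialOrder Q] [Finite Q] :
    Fintype (NonemptyFiniteChains Q) := Fintype.ofFinite _

open scoped Classical in
/-- The push-forward of a mass distribution along a map of finite types. -/
noncomputable def push {α β : Type*} [Fintype α] (f : α → β) (w : α → ℝ) (y : β) : ℝ :=
  ∑ x, if f x = y then w x else 0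

lemma push_comp {α β γ : Type*} [Fintype α] [Fintype β] (g : β → γ) (f : α → β) (w : α → ℝ) :
    push (g ∘ f) w = push g (push f w) := by
  classical
  funext z
  simp only [push, Function.comp_apply]
  have (y : β) : (if g y = z then ∑ x, if f x = y then w x else 0 else 0) =
      ∑ x, if f x = y then (if g y = z then w x else 0) else 0 := by
    split_ifs <;> simp
  simp only [this]
  rw [Finset.sum_comm]
  simp

lemma push_nonneg {α β : Type*} [Fintype α] (f : α → β) {w : α → ℝ} (hw : 0 ≤ w) :
    0 ≤ push f w :=
  fun _ => Finset.sum_nonneg fun x _ => by split_ifs; exacts [hw x, le_rfl]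

lemma exists_of_push_ne_zero {α β : Type*} [Fintype α] {f : α → β} {w : α → ℝ} {y : β}
    (h : push f w y ≠ 0) : ∃ x, w x ≠ 0 ∧ f x = y := by
  obtain ⟨x, -, hx⟩ := Finset.exists_ne_zero_of_sum_ne_zero h
  exact ⟨x, by by_contra h0; simp [h0] at hx, by by_contra h0; simp [h0] at hx⟩

lemma ChainSupported.push {α β : Type*} [Fintype α] [Preorder α] [Preorder β] {f : α → β}
    (hf : Monotone f) {w : α → ℝ} (hc : ChainSupported w) : ChainSupported (push f w) := by
  intro x y hx hy
  obtain ⟨x', hx', rfl⟩ := exists_of_push_ne_zero hx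
  obtain ⟨y', hy', rfl⟩ := exists_of_push_ne_zero hy
  exact (hc x' y' hx' hy').imp (fun h => hf h) (fun h => hf h)

lemma push_apply_of_injective {α β : Type*} [Fintype α] {f : α → β} (hf : Function.Injective f)
    (w : α → ℝ) (x : α) : push f w (f x) = w x := by
  classical
  simp [push, hf.eq_iff]

lemma sum_push {α β : Type*} [Fintype α] [Fintype β] (f : α → β) (w : α → ℝ) :
    ∑ y, push f w y = ∑ x, w x := by
  classical
  simp only [push]
  rw [Finset.sum_comm]
  simp

open scoped Classical in
/-- The function on a finite partial order `Q` obtained from a mass distribution `w` on the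
nonempty chains of `Q` by superposing the indicator functions of the chains: its superlevel sets
are the chains in the support of `w`, as soon as these are nested. -/
noncomputable def layerSum {Q : Type*} [PartialOrder Q] [Finite Q]
    (w : NonemptyFiniteChains Q → ℝ) (q : Q) : ℝ :=
  ∑ C, if q ∈ C.finset then w C else 0

variable {Q : Type*} [PartialOrder Q] [Finite Q]

open scoped Classical in
/-- For nested layers, the mass of the layers meeting a set is the maximum of the layer sum on
that set: a smallest layer meeting the set does so in a point of all larger layers. -/
lemma isGreatest_layerSum {w : NonemptyFiniteChains Q → ℝ} (hw : 0 ≤ w) (hc : ChainSupported w)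
    {D : Set Q} (hD : D.Nonempty) :
    IsGreatest (layerSum w '' D) (∑ C, if ∃ q ∈ D, q ∈ C.finset then w C else 0) := by
  refine ⟨?_, ?_⟩
  · suffices ∃ q ∈ D, ∀ C, w C ≠ 0 → (∃ q ∈ D, q ∈ C.finset) → q ∈ C.finset by
      obtain ⟨q, hq, h⟩ := this
      refine ⟨q, hq, le_antisymm ?_ ?_⟩
      · exact sum_ite_le_sum_ite hw fun C _ hC => ⟨q, hq, hC⟩
      · exact sum_ite_le_sum_ite hw h
    by_cases hT : ∃ C, w C ≠ 0 ∧ ∃ q ∈ D, q ∈ C.finset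
    · obtain ⟨C₀, ⟨hC₀, q, hq, hqC⟩, hmin⟩ :=
        Set.Finite.exists_minimal (Set.toFinite {C | w C ≠ 0 ∧ ∃ q ∈ D, q ∈ C.finset}) hT
      refine ⟨q, hq, fun C hC hCD => ?_⟩
      rcases hc C₀ C hC₀ hC with h | h
      · exact h hqC
      · exact hmin ⟨hC, hCD⟩ h hqC
    · obtain ⟨q, hq⟩ := hD
      exact ⟨q, hq, fun C hC hCD => (hT ⟨C, hC, hCD⟩).elim⟩
  · rintro _ ⟨q, hq, rfl⟩
    exact sum_ite_le_sum_ite hw fun C _ hC => ⟨q, hq, hC⟩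

lemma isGreatest_range_layerSum [Nonempty Q] {w : NonemptyFiniteChains Q → ℝ} (hw : 0 ≤ w)
    (hc : ChainSupported w) : IsGreatest (Set.range (layerSum w)) (∑ C, w C) := by
  classical
  rw [← Set.image_univ]
  convert isGreatest_layerSum hw hc Set.univ_nonempty using 2 with C
  rw [if_pos]
  obtain ⟨q, hq⟩ := C.nonempty
  exact ⟨q, trivial, hq⟩

lemma layerSum_nonneg {w : NonemptyFiniteChains Q → ℝ} (hw : 0 ≤ w) : 0 ≤ layerSum w :=
  fun _ => Finset.sum_nonneg fun C _ => by split_ifs; exacts [hw C, le_rfl]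

/-- The layer sum of a mass distribution is supported on a chain, as each layer is a chain and
the layers are nested. -/
lemma chainSupported_layerSum {w : NonemptyFiniteChains Q → ℝ} (hc : ChainSupported w) :
    ChainSupported (layerSum w) := by
  classical
  intro p q hp hq
  obtain ⟨C, -, hC⟩ := Finset.exists_ne_zero_of_sum_ne_zero hp
  obtain ⟨D, -, hD⟩ := Finset.exists_ne_zero_of_sum_ne_zero hq
  rw [ite_ne_right_iff] at hC hD
  rcases hc C D hC.2 hD.2 with h | h
  · exact D.comparable ⟨p, h hC.1⟩ ⟨q, hD.1⟩
  · exact C.comparable ⟨p, hC.1⟩ ⟨q, h hD.1⟩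

/-- The layer sum determines the masses: its maxima over sets determine the mass of the layers
meeting each set, hence by complementation the mass of the layers contained in each chain. -/
lemma layerSum_injective {w w' : NonemptyFiniteChains Q → ℝ} (hw : 0 ≤ w) (hw' : 0 ≤ w')
    (hc : ChainSupported w) (hc' : ChainSupported w') (h : layerSum w = layerSum w') : w = w' := by
  classical
  rcases isEmpty_or_nonempty Q with hQ | hQ
  · funext C
    exact isEmptyElim C.nonempty.choose
  have key (D : Set Q) : (∑ C, if ∃ q ∈ D, q ∈ C.finset then w C else 0) =
      ∑ C, if ∃ q ∈ D, q ∈ C.finset then w' C else 0 := by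
    rcases D.eq_empty_or_nonempty with rfl | hD
    · simp
    · have h1 := isGreatest_layerSum hw hc hD
      rw [h] at h1
      exact h1.unique (isGreatest_layerSum hw' hc' hD)
  have htot : ∑ C, w C = ∑ C, w' C := by
    have h1 := isGreatest_range_layerSum hw hc
    rw [h] at h1
    exact h1.unique (isGreatest_range_layerSum hw' hc')
  -- the layers contained in `C₀` are those not meeting its complement
  have compl (v : NonemptyFiniteChains Q → ℝ) (C₀ : NonemptyFiniteChains Q) :
      (∑ C, if C ≤ C₀ then v C else 0) =
        (∑ C, v C) - ∑ C, if ∃ q ∈ {q | q ∉ C₀.finset}, q ∈ C.finset then v C else 0 := by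
    rw [← Finset.sum_sub_distrib]
    refine Finset.sum_congr rfl fun C _ => ?_
    by_cases hC : C ≤ C₀
    · rw [if_pos hC, if_neg, sub_zero]
      rintro ⟨q, hq, hq'⟩
      exact hq (hC hq')
    · rw [if_neg hC, if_pos, sub_self]
      obtain ⟨q, hq, hq'⟩ := Finset.not_subset.1 hC
      exact ⟨q, hq', hq⟩
  refine eq_of_sum_le_eq fun C₀ => ?_
  rw [compl, compl, htot, key]

/-- Under a monotone map of the underlying partial orders, layer sums push forward by taking
maxima over the fibres. -/
lemma isGreatest_layerSum_push {Q' : Type*} [PartialOrder Q'] [Finite Q'] (f : Q →o Q')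
    {w : NonemptyFiniteChains Q → ℝ} (hw : 0 ≤ w) (hc : ChainSupported w) {y : Q'}
    (hy : ∃ q, f q = y) :
    IsGreatest (layerSum w '' {q | f q = y})
      (layerSum (push (NonemptyFiniteChains.orderHomMap f) w) y) := by
  classical
  convert isGreatest_layerSum hw hc (D := {q | f q = y}) hy using 1
  simp only [layerSum, push]
  have (E : NonemptyFiniteChains Q') :
      (if y ∈ E.finset then ∑ C, if NonemptyFiniteChains.orderHomMap f C = E then w C else 0
        else 0) = ∑ C, if NonemptyFiniteChains.orderHomMap f C = E then
          (if y ∈ E.finset then w C else 0) else 0 := by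
    split_ifs <;> simp
  simp only [this]
  rw [Finset.sum_comm]
  refine Finset.sum_congr rfl fun C _ => ?_
  simp [and_comm]

/-- Every nonnegative function supported on a chain is a layer sum: split off the smallest
nonzero value times the indicator of the support, and induct on the support. -/
lemma exists_layerSum_eq {h : Q → ℝ} (h0 : 0 ≤ h) (hc : ChainSupported h) :
    ∃ w : NonemptyFiniteChains Q → ℝ, 0 ≤ w ∧ ChainSupported w ∧ layerSum w = h ∧
      ∀ C, w C ≠ 0 → ∀ q ∈ C.finset, h q ≠ 0 := by
  classical
  have := Fintype.ofFinite Q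
  induction hn : (Finset.univ.filter fun q => h q ≠ 0).card using Nat.strong_induction_on
    generalizing h with
  | _ n ih =>
  by_cases hS : (Finset.univ.filter fun q => h q ≠ 0).Nonempty
  swap
  · have : h = 0 := by
      funext q
      by_contra hq
      exact hS ⟨q, by simpa using hq⟩
    subst this
    exact ⟨0, le_rfl, by simp [ChainSupported], by funext q; simp [layerSum], by simp⟩
  let S : NonemptyFiniteChains Q :=
    { finset := Finset.univ.filter fun q => h q ≠ 0
      nonempty := hS
      comparable := fun a b => hc a b (Finset.mem_filter.1 a.2).2 (Finset.mem_filter.1 b.2).2 }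
  have hS' (q : Q) : q ∈ S.finset ↔ h q ≠ 0 := by simp [S]
  obtain ⟨q₀, hq₀, hmin⟩ := Finset.exists_min_image S.finset h S.nonempty
  let h' : Q → ℝ := fun q => h q - if q ∈ S.finset then h q₀ else 0
  have hsub (q : Q) (hq : h' q ≠ 0) : h q ≠ 0 := by
    intro h1
    have : q ∉ S.finset := by simp [hS', h1]
    exact hq (by simp [h', h1, this])
  obtain ⟨w, hw0, hwc, hwl, hws⟩ := ih _ (by
    rw [← hn]
    refine Finset.card_lt_card (Finset.ssubset_iff_of_subset ?_ |>.2 ⟨q₀, hq₀, ?_⟩)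
    · intro q hq
      simp only [Finset.mem_filter, Finset.mem_univ, true_and] at hq ⊢
      exact hsub q hq
    · simp [h', hq₀]) (h := h') (fun q => by
        by_cases hq : q ∈ S.finset
        · simpa [h', hq] using hmin q hq
        · simpa [h', hq] using h0 q)
      (fun x y hx hy => hc x y (hsub x hx) (hsub y hy)) rfl
  have hle (C) (hC : w C ≠ 0) : C ≤ S := fun q hq => (hS' q).2 (hsub q (hws C hC q hq))
  have hle' (C) (hC : w C + (if C = S then h q₀ else 0) ≠ 0) : w C ≠ 0 ∨ C = S := by
    by_contra! hcon
    simp [hcon.1, hcon.2] at hC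
  refine ⟨fun C => w C + if C = S then h q₀ else 0, fun C => ?_, ?_, ?_, fun C hC q hq => ?_⟩
  · refine add_nonneg (hw0 C) ?_
    split_ifs
    exacts [h0 _, le_rfl]
  · intro C D hC hD
    rcases hle' C hC with hC | rfl <;> rcases hle' D hD with hD | rfl
    · exact hwc C D hC hD
    · exact Or.inl (hle C hC)
    · exact Or.inr (hle D hD)
    · exact Or.inl le_rfl
  · funext q
    have h1 := congrFun hwl q
    simp only [layerSum, h'] at h1 ⊢
    have (C : NonemptyFiniteChains Q) :
        (if q ∈ C.finset then w C + (if C = S then h q₀ else 0) else 0) =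
          (if q ∈ C.finset then w C else 0) +
            if C = S then (if q ∈ S.finset then h q₀ else 0) else 0 := by
      by_cases hCS : C = S
      · subst hCS; split_ifs <;> simp
      · simp [hCS]
    simp only [this, Finset.sum_add_distrib, h1]
    simp
  · rcases hle' C hC with hC | rfl
    · exact hsub q (hws C hC q hq)
    · exact (hS' q).1 hq

end Layers

/-! ### Left adjoints on simplicial sets -/

open Opposite

section LeftAdjoints

variable {C : Type*} [Category C] {L : SSet.{u} ⥤ C} {R : C ⥤ SSet.{u}}

/-- Morphisms out of the value of a left adjoint at a simplicial set `X` are determined by their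
restrictions along the simplices of `X`. -/
lemma hom_ext_of_adjunction (adj : L ⊣ R) {X : SSet.{u}} {Z : C} {f g : L.obj X ⟶ Z}
    (h : ∀ (n : SimplexCategory) (x : X.obj (op n)),
      L.map (SSet.yonedaEquiv.symm x) ≫ f = L.map (SSet.yonedaEquiv.symm x) ≫ g) : f = g := by
  refine (adj.homEquiv X Z).injective ?_
  ext ⟨n⟩ x
  have h1 := congrArg (adj.homEquiv _ _) (h n x)
  rw [adj.homEquiv_naturality_left, adj.homEquiv_naturality_left, SSet.yonedaEquiv_symm_comp,
    SSet.yonedaEquiv_symm_comp] at h1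
  exact SSet.yonedaEquiv.symm.injective h1

/-- A compatible family of morphisms on the simplices of `X` extends to the value at `X` of a
left adjoint. -/
lemma exists_desc_of_adjunction (adj : L ⊣ R) {X : SSet.{u}} {Z : C}
    (φ : ∀ (n : SimplexCategory), X.obj (op n) → (L.obj (SSet.stdSimplex.obj n) ⟶ Z))
    (hφ : ∀ {n m : SimplexCategory} (f : n ⟶ m) (x : X.obj (op m)),
      φ n (X.map f.op x) = L.map (SSet.stdSimplex.map f) ≫ φ m x) :
    ∃ d : L.obj X ⟶ Z, ∀ (n : SimplexCategory) (x : X.obj (op n)),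
      L.map (SSet.yonedaEquiv.symm x) ≫ d = φ n x := by
  let d : X ⟶ R.obj Z :=
    { app := fun n => ↾fun x => SSet.yonedaEquiv (adj.homEquiv _ _ (φ n.unop x))
      naturality := by
        rintro ⟨n⟩ ⟨m⟩ f
        ext x
        obtain ⟨f, rfl⟩ : ∃ g : m ⟶ n, f = g.op := ⟨f.unop, rfl⟩
        have h1 := congrArg (adj.homEquiv _ _) (hφ f x)
        rw [adj.homEquiv_naturality_left] at h1
        have h2 := congrArg SSet.yonedaEquiv h1
        refine h2.trans ?_
        exact (SSet.yonedaEquiv_naturality _ _).symm }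
  refine ⟨(adj.homEquiv _ _).symm d, fun n x => ?_⟩
  rw [← adj.homEquiv_naturality_left_symm, SSet.yonedaEquiv_symm_comp, Equiv.symm_apply_eq,
    Equiv.symm_apply_eq]
  rfl

end LeftAdjoints

lemma toTop_map_map {X Y Z : SSet.{u}} (f : X ⟶ Y) (g : Y ⟶ Z) (p : (|X| : TopCat.{u})) :
    SSet.toTop.map g (SSet.toTop.map f p) = SSet.toTop.map (f ≫ g) p := by
  rw [Functor.map_comp]
  rfl

/-- Every point of a geometric realization lies in the image of a simplex. -/
lemma exists_toTop_map_eq {X : SSet.{u}} (p : (|X| : TopCat.{u})) :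
    ∃ (n : SimplexCategory) (x : X.obj (op n)) (y : (|SSet.stdSimplex.obj n| : TopCat.{u})),
      SSet.toTop.map (SSet.yonedaEquiv.symm x) y = p := by
  let S : Set (|X| : TopCat.{u}) := {p | ∃ (n : SimplexCategory) (x : X.obj (op n))
    (y : (|SSet.stdSimplex.obj n| : TopCat.{u})), SSet.toTop.map (SSet.yonedaEquiv.symm x) y = p}
  let ι : TopCat.of S ⟶ |X| := TopCat.ofHom ⟨Subtype.val, continuous_subtype_val⟩
  obtain ⟨d, hd⟩ := exists_desc_of_adjunction sSetTopAdj (X := X) (Z := TopCat.of S)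
    (fun n x => TopCat.ofHom ⟨fun y => ⟨SSet.toTop.map (SSet.yonedaEquiv.symm x) y, n, x, y, rfl⟩,
      by fun_prop⟩) (by
      intro n m f x
      ext y
      change SSet.toTop.map _ y = SSet.toTop.map _ (SSet.toTop.map _ y)
      rw [← SSet.yonedaEquiv_symm_naturality_left, Functor.map_comp]
      rfl)
  have h : d ≫ ι = 𝟙 _ := by
    refine hom_ext_of_adjunction sSetTopAdj fun n x => ?_
    rw [← Category.assoc, hd, Category.comp_id]
    rfl
  have h2 : ι (d p) = p := ConcreteCategory.congr_hom h p
  rw [← h2]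
  exact (d p).2

/-- Every simplex of a subdivision lies in the image of the subdivision of a simplex. -/
lemma exists_sd_map_eq {X : SSet.{u}} {k : SimplexCategoryᵒᵖ} (p : (SSet.sd.obj X).obj k) :
    ∃ (n : SimplexCategory) (x : X.obj (op n)) (y : (SSet.sd.obj (SSet.stdSimplex.obj n)).obj k),
      (SSet.sd.map (SSet.yonedaEquiv.symm x)).app k y = p := by
  let S : (SSet.sd.obj X).Subcomplex :=
    ⨆ (x : Σ n : SimplexCategory, X.obj (op n)),
      SSet.Subcomplex.range (SSet.sd.map (SSet.yonedaEquiv.symm x.2))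
  have hS (n : SimplexCategory) (x : X.obj (op n)) :
      SSet.Subcomplex.range (SSet.sd.map (SSet.yonedaEquiv.symm x)) ≤ S :=
    le_iSup (fun x : Σ n : SimplexCategory, X.obj (op n) =>
      SSet.Subcomplex.range (SSet.sd.map (SSet.yonedaEquiv.symm x.2))) ⟨n, x⟩
  obtain ⟨d, hd⟩ := exists_desc_of_adjunction SSet.sdExAdjunction (X := X) (Z := S)
    (fun n x => SSet.Subcomplex.lift (SSet.sd.map (SSet.yonedaEquiv.symm x)) (hS n x)) (by
      intro n m f x
      rw [← cancel_mono S.ι]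
      simp [← SSet.yonedaEquiv_symm_naturality_left])
  have h : d ≫ S.ι = 𝟙 _ := by
    refine hom_ext_of_adjunction SSet.sdExAdjunction fun n x => ?_
    rw [← Category.assoc, hd, Category.comp_id]
    simp
  have h2 : S.ι.app k (d.app k p) = p := ConcreteCategory.congr_hom (congr_app h k) p
  have h3 : p ∈ S.obj k := by
    rw [← h2]
    exact (d.app k p).2
  simp only [S, CategoryTheory.Subfunctor.iSup_obj, Set.mem_iUnion] at h3
  obtain ⟨⟨n, x⟩, y, hy⟩ := h3
  exact ⟨n, x, y, hy⟩

/-! ### Barycentric coordinates on nerves of partial orders -/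

/-- A nonempty finite chain of a partial order can be enumerated increasingly. -/
lemma exists_strictMono_range_eq {P : Type*} [PartialOrder P] {S : Finset P} (hne : S.Nonempty)
    (hS : ∀ a ∈ S, ∀ b ∈ S, a ≤ b ∨ b ≤ a) :
    ∃ (n : ℕ) (f : Fin (n + 1) → P), StrictMono f ∧ ∀ q, q ∈ Set.range f ↔ q ∈ S := by
  -- enumerate with respect to a linear extension of the order
  let S' : Finset (LinearExtension P) := S
  obtain ⟨n, hn⟩ := Nat.exists_eq_succ_of_ne_zero hne.card_pos.ne'
  let e := S'.orderEmbOfFin hn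
  let f : Fin (n + 1) → P := e
  have hf (q : P) : q ∈ Set.range f ↔ q ∈ S := by
    have h : (toLinearExtension q : LinearExtension P) ∈ Set.range e ↔
        toLinearExtension q ∈ S' := by
      rw [Set.ext_iff.1 (Finset.range_orderEmbOfFin S' hn)]; rfl
    exact h
  refine ⟨n, f, fun i j hij => ?_, hf⟩
  refine lt_of_le_of_ne ?_ fun h => hij.ne (e.injective h)
  refine (hS (f i) ((hf _).1 ⟨i, rfl⟩) (f j) ((hf _).1 ⟨j, rfl⟩)).resolve_right fun h => ?_
  have h1 : e j ≤ e i := (toLinearExtension (α := P)).monotone h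
  exact hij.not_ge (e.le_iff_le.1 h1)

lemma eq_of_range_eq {P : Type*} {n n' : ℕ} {f : Fin (n + 1) → P} {g : Fin (n' + 1) → P}
    (hf : Function.Injective f) (hg : Function.Injective g) (h : Set.range f = Set.range g) :
    n = n' := by
  have h1 := congrArg Set.ncard h
  rw [← Set.image_univ, ← Set.image_univ, Set.ncard_image_of_injective _ hf,
    Set.ncard_image_of_injective _ hg] at h1
  simpa [Set.ncard_univ] using h1

lemma coe_stdSimplex_map {α β : Type*} [Fintype α] [Fintype β] (f : α → β)
    (t : stdSimplex ℝ α) : ⇑(stdSimplex.map f t) = push f t := by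
  classical
  funext y
  simp [stdSimplex.map_coe, FunOnFinite.linearMap_apply_apply, push, Finset.sum_filter]

/-- Every point of a simplex lies in the interior of a face. -/
lemma exists_map_eq_of_stdSimplex {n : ℕ} (t : stdSimplex ℝ (Fin (n + 1))) :
    ∃ (m : ℕ) (f : Fin (m + 1) →o Fin (n + 1)) (t' : stdSimplex ℝ (Fin (m + 1))),
      (∀ i, t' i ≠ 0) ∧ stdSimplex.map f t' = t := by
  classical
  have hS : (Finset.univ.filter fun i => t i ≠ 0).Nonempty := by
    have h : ∑ i, t i ≠ 0 := by rw [stdSimplex.sum_eq_one]; exact one_ne_zero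
    obtain ⟨i, -, hi⟩ := Finset.exists_ne_zero_of_sum_ne_zero h
    exact ⟨i, by simpa using hi⟩
  obtain ⟨m, f, hf, hfS⟩ := exists_strictMono_range_eq hS fun a _ b _ => le_total a b
  simp only [Finset.mem_filter, Finset.mem_univ, true_and] at hfS
  have h0 : ∀ j, j ∉ Set.range f → t j = 0 := fun j hj => by
    by_contra h
    exact hj ((hfS j).2 h)
  have hsum : ∑ i, t (f i) = 1 := by
    rw [← stdSimplex.sum_eq_one t]
    exact Fintype.sum_of_injective f hf.injective _ _ h0 fun _ => rfl
  refine ⟨m, ⟨f, hf.monotone⟩, ⟨fun i => t (f i), fun i => stdSimplex.zero_le t _, hsum⟩,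
    fun i => (hfS _).1 ⟨i, rfl⟩, ?_⟩
  refine stdSimplex.ext ?_
  rw [coe_stdSimplex_map]
  funext j
  by_cases hj : j ∈ Set.range f
  · obtain ⟨i, rfl⟩ := hj
    exact push_apply_of_injective hf.injective _ i
  · rw [h0 j hj]
    by_contra hne
    obtain ⟨i, -, hi⟩ := exists_of_push_ne_zero hne
    exact hj ⟨i, hi⟩

section Weights

variable {P : Type u} [PartialOrder P]

lemma exists_weights (P : Type u) [PartialOrder P] :
    ∃ W : |nerve P| ⟶ TopCat.of (P → ℝ), ∀ (n : SimplexCategory) (x : (nerve P).obj (op n))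
      (y : (|SSet.stdSimplex.obj n| : TopCat.{u})),
      W (SSet.toTop.map (SSet.yonedaEquiv.symm x) y) =
        push x.obj (SimplexCategory.toTopHomeo n y) := by
  obtain ⟨W, hW⟩ := exists_desc_of_adjunction sSetTopAdj (X := nerve P) (Z := TopCat.of (P → ℝ))
    (fun n x => TopCat.ofHom ⟨fun y => push x.obj (SimplexCategory.toTopHomeo n y), by
      refine continuous_pi fun p => continuous_finsetSum _ fun i _ => ?_
      split_ifs
      · exact (continuous_apply i).comp
          (continuous_subtype_val.comp (SimplexCategory.toTopHomeo n).continuous)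
      · exact continuous_const⟩) (by
      intro n m f x
      refine TopCat.hom_ext (ContinuousMap.ext fun y => ?_)
      change push (x.obj ∘ f) _ = push x.obj (SimplexCategory.toTopHomeo m
        (SSet.toTop.map (SSet.stdSimplex.map f) y))
      rw [SimplexCategory.toTopHomeo_naturality_apply, coe_stdSimplex_map, push_comp])
  exact ⟨W, fun n x y => ConcreteCategory.congr_hom (hW n x) y⟩

/-- The barycentric coordinates of a point of the realization of the nerve of a partial order,
as a function on the set of vertices. -/
noncomputable def weights (P : Type u) [PartialOrder P] : |nerve P| ⟶ TopCat.of (P → ℝ) :=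
  (exists_weights P).choose

/-- The point with barycentric coordinates `t` on the simplex of the nerve of `P` given by the
chain `x`. -/
noncomputable def nervePoint {n : ℕ} (x : (nerve P) _⦋n⦌) (t : stdSimplex ℝ (Fin (n + 1))) :
    (|nerve P| : TopCat.{u}) :=
  SSet.toTop.map (SSet.yonedaEquiv.symm x) (SimplexCategory.toTopHomeo ⦋n⦌ |>.symm t)

lemma weights_nervePoint {n : ℕ} (x : (nerve P) _⦋n⦌) (t : stdSimplex ℝ (Fin (n + 1))) :
    weights P (nervePoint x t) = push x.obj t := by
  have h := (exists_weights P).choose_spec ⦋n⦌ x ((SimplexCategory.toTopHomeo ⦋n⦌).symm t)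
  rw [Homeomorph.apply_symm_apply] at h
  exact h

lemma nervePoint_map {n m : ℕ} (f : ⦋n⦌ ⟶ ⦋m⦌) (x : (nerve P) _⦋m⦌)
    (t : stdSimplex ℝ (Fin (n + 1))) :
    nervePoint ((nerve P).map f.op x) t = nervePoint x (stdSimplex.map f t) := by
  unfold nervePoint
  have h := SimplexCategory.toTopHomeo_symm_naturality_apply.{u} f t
  refine Eq.trans ?_ (congrArg (SSet.toTop.map (SSet.yonedaEquiv.symm x)) h.symm)
  rw [← SSet.yonedaEquiv_symm_naturality_left, Functor.map_comp]
  rfl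

lemma exists_nervePoint_eq (p : (|nerve P| : TopCat.{u})) :
    ∃ (n : ℕ) (x : (nerve P) _⦋n⦌) (t : stdSimplex ℝ (Fin (n + 1))), nervePoint x t = p := by
  obtain ⟨n, x, y, h⟩ := exists_toTop_map_eq p
  refine ⟨n.len, x, SimplexCategory.toTopHomeo n y, ?_⟩
  rw [← h]
  exact congrArg _ ((SimplexCategory.toTopHomeo n).symm_apply_apply y)

/-- Every point of the realization of the nerve of a partial order lies in the interior of a
simplex given by a strictly increasing chain. -/
lemma exists_nervePoint_eq_of_strictMono (p : (|nerve P| : TopCat.{u})) :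
    ∃ (n : ℕ) (x : (nerve P) _⦋n⦌) (t : stdSimplex ℝ (Fin (n + 1))),
      StrictMono x.obj ∧ (∀ i, t i ≠ 0) ∧ nervePoint x t = p := by
  obtain ⟨n, x, t, rfl⟩ := exists_nervePoint_eq p
  obtain ⟨m, f, t', ht', rfl⟩ := exists_map_eq_of_stdSimplex t
  let g : ⦋m⦌ ⟶ ⦋n⦌ := SimplexCategory.Hom.mk f
  obtain ⟨k, e, he, z, hz⟩ := SSet.exists_nonDegenerate _ ((nerve P).map g.op x)
  refine ⟨k, z.1, stdSimplex.map e t',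
    (PartialOrder.mem_nerve_nonDegenerate_iff_strictMono _).1 z.2, fun i => ?_, ?_⟩
  · obtain ⟨j, rfl⟩ := SimplexCategory.epi_iff_surjective.1 he i
    rw [coe_stdSimplex_map]
    refine ((stdSimplex.zero_le t' j).lt_of_ne' (ht' j)).trans_le ?_ |>.ne'
    refine le_trans ?_ (Finset.single_le_sum (fun x _ => ?_) (Finset.mem_univ j))
    · exact (if_pos rfl).ge
    · split_ifs; exacts [stdSimplex.zero_le t' _, le_rfl]
  · rw [← nervePoint_map, ← hz, nervePoint_map]
    rfl

lemma weights_nonneg (p : (|nerve P| : TopCat.{u})) : 0 ≤ weights P p := by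
  obtain ⟨n, x, t, rfl⟩ := exists_nervePoint_eq p
  rw [weights_nervePoint]
  exact push_nonneg _ fun i => stdSimplex.zero_le t i

lemma chainSupported_weights (p : (|nerve P| : TopCat.{u})) : ChainSupported (weights P p) := by
  obtain ⟨n, x, t, rfl⟩ := exists_nervePoint_eq p
  rw [weights_nervePoint]
  exact ChainSupported.push x.monotone fun i j _ _ => le_total i j

lemma sum_weights [Fintype P] (p : (|nerve P| : TopCat.{u})) : ∑ i, weights P p i = 1 := by
  obtain ⟨n, x, t, rfl⟩ := exists_nervePoint_eq p
  rw [weights_nervePoint, sum_push, stdSimplex.sum_eq_one]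

/-- A point in the interior of a strictly increasing chain is recovered from its barycentric
coordinates: their support is the chain. -/
lemma weights_injective : Function.Injective (weights P) := by
  have supp {n : ℕ} {x : (nerve P) _⦋n⦌} (hx : StrictMono x.obj)
      {t : stdSimplex ℝ (Fin (n + 1))} (ht : ∀ i, t i ≠ 0) (q : P) :
      push x.obj t q ≠ 0 ↔ q ∈ Set.range x.obj := by
    refine ⟨fun h => ?_, ?_⟩
    · obtain ⟨i, -, hi⟩ := exists_of_push_ne_zero h
      exact ⟨i, hi⟩
    · rintro ⟨i, rfl⟩
      rw [push_apply_of_injective hx.injective]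
      exact ht i
  intro p p' h
  obtain ⟨n, x, t, hx, ht, rfl⟩ := exists_nervePoint_eq_of_strictMono p
  obtain ⟨n', x', t', hx', ht', rfl⟩ := exists_nervePoint_eq_of_strictMono p'
  rw [weights_nervePoint, weights_nervePoint] at h
  have hr : Set.range x.obj = Set.range x'.obj := by
    ext q
    rw [← supp hx ht, ← supp hx' ht', h]
  obtain rfl : n = n' := eq_of_range_eq hx.injective hx'.injective hr
  have hobj : x.obj = x'.obj := (hx.range_inj hx').1 hr
  obtain rfl : x = x' := nerve.ext_of_isThin hobj
  congr 1
  refine stdSimplex.ext (funext fun i => ?_)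
  rw [← push_apply_of_injective hx.injective t i, h, push_apply_of_injective hx.injective]

/-- Barycentric coordinates push forward along monotone maps. -/
lemma weights_nerveMap [Fintype P] {P' : Type u} [PartialOrder P'] (f : P →o P')
    (p : (|nerve P| : TopCat.{u})) :
    weights P' (SSet.toTop.map (nerveMap f.monotone.functor) p) = push f (weights P p) := by
  obtain ⟨n, x, t, rfl⟩ := exists_nervePoint_eq p
  rw [weights_nervePoint, ← push_comp]
  have h : SSet.toTop.map (nerveMap f.monotone.functor) (nervePoint x t) =
      nervePoint ((nerveMap f.monotone.functor).app _ x) t := by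
    unfold nervePoint
    rw [← SSet.yonedaEquiv_symm_comp, Functor.map_comp]
    rfl
  rw [h, weights_nervePoint]
  rfl

/-- Every chain-supported probability distribution on a finite partial order is the tuple of
barycentric coordinates of a point of the realization of the nerve. -/
lemma exists_weights_eq [Fintype P] {w : P → ℝ} (hw : 0 ≤ w) (hc : ChainSupported w)
    (hs : ∑ i, w i = 1) : ∃ p, weights P p = w := by
  classical
  have hS : (Finset.univ.filter fun i => w i ≠ 0).Nonempty := by
    have h : ∑ i, w i ≠ 0 := by rw [hs]; exact one_ne_zero
    obtain ⟨i, -, hi⟩ := Finset.exists_ne_zero_of_sum_ne_zero h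
    exact ⟨i, by simpa using hi⟩
  obtain ⟨m, f, hf, hfS⟩ := exists_strictMono_range_eq hS fun a ha b hb =>
    hc a b (Finset.mem_filter.1 ha).2 (Finset.mem_filter.1 hb).2
  simp only [Finset.mem_filter, Finset.mem_univ, true_and] at hfS
  have h0 : ∀ q, q ∉ Set.range f → w q = 0 := fun q hq => by
    by_contra h
    exact hq ((hfS q).2 h)
  let t : stdSimplex ℝ (Fin (m + 1)) := ⟨fun i => w (f i), fun i => hw _, by
    rw [← hs]
    exact Fintype.sum_of_injective f hf.injective _ _ h0 fun _ => rfl⟩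
  let x : (nerve P) _⦋m⦌ := hf.monotone.functor
  refine ⟨nervePoint x t, (weights_nervePoint x t).trans ?_⟩
  funext q
  by_cases hq : q ∈ Set.range f
  · obtain ⟨i, rfl⟩ := hq
    exact push_apply_of_injective hf.injective _ i
  · rw [h0 q hq]
    by_contra hne
    obtain ⟨i, -, hi⟩ := exists_of_push_ne_zero hne
    exact hq ⟨i, hi⟩

end Weights

/-! ### Subdivision of the nerve of a partial order -/

section SubdivisionOfNerve

open PartialOrder

/-- The map of nerves of partial orders of nonempty finite chains induced by a monotone map. -/
noncomputable def chainsMap {P Q : Type u} [PartialOrder P] [PartialOrder Q] (f : P →o Q) :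
    nerve (NonemptyFiniteChains P) ⟶ nerve (NonemptyFiniteChains Q) :=
  nerveMap (NonemptyFiniteChains.orderHomMap f).monotone.functor

variable {P Q R : Type u} [PartialOrder P] [PartialOrder Q] [PartialOrder R]

lemma chainsMap_app_obj (f : P →o Q) {n : SimplexCategoryᵒᵖ}
    (y : (nerve (NonemptyFiniteChains P)).obj n) (i : Fin (n.unop.len + 1)) :
    ((chainsMap f).app n y).obj i = (y.obj i).map f := rfl

lemma chainsMap_comp (f : P →o Q) (g : Q →o R) :
    chainsMap f ≫ chainsMap g = chainsMap (g.comp f) := by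
  refine NatTrans.ext (funext fun n => ConcreteCategory.hom_ext _ _ fun y => ?_)
  refine nerve.ext_of_isThin (funext fun i => ?_)
  refine NonemptyFiniteChains.ext (Finset.ext fun r => ?_)
  change r ∈ (((y.obj i).map f).map g).finset ↔ r ∈ ((y.obj i).map (g.comp f)).finset
  simp

/-- The monotone map underlying a morphism of the simplex category, lifted to the universe `u`. -/
def uliftHom {n m : SimplexCategory} (f : n ⟶ m) :
    ULift.{u} (Fin (n.len + 1)) →o ULift.{u} (Fin (m.len + 1)) where
  toFun i := ⟨f i.down⟩
  monotone' _ _ h := f.toOrderHom.monotone h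

/-- The monotone map underlying a simplex of the nerve of a partial order. -/
def simplexHom {n : SimplexCategory} (x : (nerve Q).obj (op n)) :
    ULift.{u} (Fin (n.len + 1)) →o Q where
  toFun i := x.obj i.down
  monotone' _ _ h := x.monotone h

/-- The subdivision of a simplex is the nerve of its partial order of faces. -/
noncomputable def sdSimplexIso (n : SimplexCategory) :
    SSet.sd.obj (SSet.stdSimplex.{u}.obj n) ≅
      nerve (NonemptyFiniteChains (ULift.{u} (Fin (n.len + 1)))) :=
  SSet.stdSimplex.sdIso.app n

lemma sdSimplexIso_hom_naturality {n m : SimplexCategory} (f : n ⟶ m) :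
    SSet.sd.map (SSet.stdSimplex.{u}.map f) ≫ (sdSimplexIso m).hom =
      (sdSimplexIso n).hom ≫ chainsMap (uliftHom f) :=
  SSet.stdSimplex.sdIso.hom.naturality f

lemma exists_sdNerve (Q : Type u) [PartialOrder Q] :
    ∃ b : SSet.sd.obj (nerve Q) ⟶ nerve (NonemptyFiniteChains Q),
      ∀ (n : SimplexCategory) (x : (nerve Q).obj (op n)),
        SSet.sd.map (SSet.yonedaEquiv.symm x) ≫ b =
          (sdSimplexIso n).hom ≫ chainsMap (simplexHom x) := by
  refine exists_desc_of_adjunction SSet.sdExAdjunction (X := nerve Q)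
    (fun n x => (sdSimplexIso n).hom ≫ chainsMap (simplexHom x)) fun {n m} f x => ?_
  rw [← Category.assoc, sdSimplexIso_hom_naturality, Category.assoc, chainsMap_comp]
  rfl

/-- The comparison map from the subdivision of the nerve of a partial order to the nerve of its
partial order of nonempty finite chains. -/
noncomputable def sdNerve (Q : Type u) [PartialOrder Q] :
    SSet.sd.obj (nerve Q) ⟶ nerve (NonemptyFiniteChains Q) :=
  (exists_sdNerve Q).choose

lemma sd_map_comp_sdNerve {n : SimplexCategory} (x : (nerve Q).obj (op n)) :
    SSet.sd.map (SSet.yonedaEquiv.symm x) ≫ sdNerve Q =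
      (sdSimplexIso n).hom ≫ chainsMap (simplexHom x) :=
  (exists_sdNerve Q).choose_spec n x

lemma sdNerve_naturality (f : P →o Q) :
    SSet.sd.map (nerveMap f.monotone.functor) ≫ sdNerve Q = sdNerve P ≫ chainsMap f := by
  refine hom_ext_of_adjunction SSet.sdExAdjunction fun n x => ?_
  rw [← Category.assoc, ← Functor.map_comp, SSet.yonedaEquiv_symm_comp, sd_map_comp_sdNerve,
    ← Category.assoc, sd_map_comp_sdNerve, Category.assoc, chainsMap_comp]
  rfl

/-- The simplex of the subdivision of the nerve of `Q` represented by a simplex `x` of the nerve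
and an increasing sequence `y` of faces of the simplex. -/
noncomputable def sdPoint {n : SimplexCategory} {k : SimplexCategoryᵒᵖ}
    (x : (nerve Q).obj (op n))
    (y : (nerve (NonemptyFiniteChains (ULift.{u} (Fin (n.len + 1))))).obj k) :
    (SSet.sd.obj (nerve Q)).obj k :=
  (SSet.sd.map (SSet.yonedaEquiv.symm x)).app k ((sdSimplexIso n).inv.app k y)

lemma sdNerve_sdPoint {n : SimplexCategory} {k : SimplexCategoryᵒᵖ} (x : (nerve Q).obj (op n))
    (y : (nerve (NonemptyFiniteChains (ULift.{u} (Fin (n.len + 1))))).obj k) :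
    (sdNerve Q).app k (sdPoint x y) = (chainsMap (simplexHom x)).app k y := by
  have h : (sdSimplexIso n).inv ≫ SSet.sd.map (SSet.yonedaEquiv.symm x) ≫ sdNerve Q =
      chainsMap (simplexHom x) := by
    rw [sd_map_comp_sdNerve, Iso.inv_hom_id_assoc]
  exact ConcreteCategory.congr_hom (congr_app h k) y

lemma sdPoint_map {n m : SimplexCategory} {k : SimplexCategoryᵒᵖ} (f : n ⟶ m)
    (x : (nerve Q).obj (op m))
    (y : (nerve (NonemptyFiniteChains (ULift.{u} (Fin (n.len + 1))))).obj k) :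
    sdPoint ((nerve Q).map f.op x) y = sdPoint x ((chainsMap (uliftHom f)).app k y) := by
  have h : (sdSimplexIso n).inv ≫ SSet.sd.map (SSet.yonedaEquiv.symm ((nerve Q).map f.op x)) =
      chainsMap (uliftHom f) ≫ (sdSimplexIso m).inv ≫ SSet.sd.map (SSet.yonedaEquiv.symm x) := by
    rw [Iso.inv_comp_eq, ← Category.assoc, ← sdSimplexIso_hom_naturality, Category.assoc,
      Iso.hom_inv_id_assoc, ← SSet.yonedaEquiv_symm_naturality_left, Functor.map_comp]
  exact ConcreteCategory.congr_hom (congr_app h k) y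

lemma exists_sdPoint_eq {k : SimplexCategoryᵒᵖ} (p : (SSet.sd.obj (nerve Q)).obj k) :
    ∃ (n : ℕ) (x : (nerve Q) _⦋n⦌)
      (y : (nerve (NonemptyFiniteChains (ULift.{u} (Fin (n + 1))))).obj k), sdPoint x y = p := by
  obtain ⟨n, x, y, h⟩ := exists_sd_map_eq p
  refine ⟨n.len, x, (sdSimplexIso n).hom.app k y, ?_⟩
  rw [← h]
  exact congrArg _ (ConcreteCategory.congr_hom (congr_app (sdSimplexIso n).hom_inv_id k) y)

/-- An increasing sequence of nonempty finite chains of `Q` comes from a sequence of faces of the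
simplex of the nerve of `Q` given by the largest of them. -/
lemma exists_chainsMap_simplexHom_eq {k : ℕ} (z : (nerve (NonemptyFiniteChains Q)) _⦋k⦌) :
    ∃ (m : ℕ) (x : (nerve Q) _⦋m⦌)
      (y : (nerve (NonemptyFiniteChains (ULift.{u} (Fin (m + 1))))) _⦋k⦌),
      (∀ i, i ∈ (y.obj (Fin.last k)).finset) ∧ (chainsMap (simplexHom x)).app _ y = z := by
  classical
  obtain ⟨m, f, hf, hfS⟩ := exists_strictMono_range_eq (z.obj (Fin.last k)).nonempty
    fun a ha b hb => (z.obj (Fin.last k)).comparable ⟨a, ha⟩ ⟨b, hb⟩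
  have hlast (r : Fin (k + 1)) (q) (hq : q ∈ (z.obj r).finset) : ∃ j, f j = q :=
    (hfS _).2 (z.monotone (Fin.le_last r) hq)
  let c (r : Fin (k + 1)) : NonemptyFiniteChains (ULift.{u} (Fin (m + 1))) :=
    { finset := Finset.univ.filter fun j => f j.down ∈ (z.obj r).finset
      nonempty := by
        obtain ⟨q, hq⟩ := (z.obj r).nonempty
        obtain ⟨j, rfl⟩ := hlast r q hq
        exact ⟨ULift.up j, by simpa using hq⟩
      comparable := fun a b => le_total a.1 b.1 }
  have mem_c (r j) : j ∈ (c r).finset ↔ f j.down ∈ (z.obj r).finset := by simp [c]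
  have hc : Monotone c := fun r s hrs j hj => by
    rw [mem_c] at hj ⊢
    exact z.monotone hrs hj
  refine ⟨m, hf.monotone.functor, hc.functor, fun i => ?_, ?_⟩
  · exact (mem_c _ _).2 ((hfS _).1 ⟨_, rfl⟩)
  · refine nerve.ext_of_isThin (funext fun r => NonemptyFiniteChains.ext (Finset.ext fun q => ?_))
    change q ∈ ((c r).map _).finset ↔ _
    simp only [NonemptyFiniteChains.mem_map_iff, mem_c]
    constructor
    · rintro ⟨j, hj, rfl⟩
      exact hj
    · intro hq
      obtain ⟨j, rfl⟩ := hlast r q hq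
      exact ⟨ULift.up j, hq, rfl⟩

/-- Every simplex of the subdivision of the nerve of `Q` is represented by a strictly increasing
chain together with an increasing sequence of faces ending with the whole chain. -/
lemma exists_sdPoint_eq_of_strictMono {k : ℕ} (p : (SSet.sd.obj (nerve Q)) _⦋k⦌) :
    ∃ (n : ℕ) (x : (nerve Q) _⦋n⦌)
      (y : (nerve (NonemptyFiniteChains (ULift.{u} (Fin (n + 1))))) _⦋k⦌),
      StrictMono x.obj ∧ (∀ i, i ∈ (y.obj (Fin.last k)).finset) ∧ sdPoint x y = p := by
  obtain ⟨n, x, y, rfl⟩ := exists_sdPoint_eq p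
  obtain ⟨m, w, y', hy', rfl⟩ := exists_chainsMap_simplexHom_eq y
  let f : ⦋m⦌ ⟶ ⦋n⦌ := SimplexCategory.Hom.mk ⟨fun i => (w.obj i).down, fun _ _ h => w.monotone h⟩
  obtain ⟨l, e, he, z, hz⟩ := SSet.exists_nonDegenerate _ ((nerve Q).map f.op x)
  refine ⟨l, z.1, (chainsMap (uliftHom e)).app _ y',
    (PartialOrder.mem_nerve_nonDegenerate_iff_strictMono _).1 z.2, fun i => ?_, ?_⟩
  · obtain ⟨j, hj⟩ := SimplexCategory.epi_iff_surjective.1 he i.down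
    rw [chainsMap_app_obj, NonemptyFiniteChains.mem_map_iff]
    exact ⟨ULift.up j, hy' _, ULift.ext _ _ hj⟩
  · rw [← sdPoint_map, ← hz, sdPoint_map]
    rfl

/-- In the representation by a strictly increasing chain and faces ending with the whole chain,
the largest image chain recovers the chain, and the others recover the faces. -/
lemma sdNerve_app_injective {k : ℕ} : Function.Injective ((sdNerve Q).app (op ⦋k⦌)) := by
  intro p p' h
  obtain ⟨n, x, y, hx, hy, rfl⟩ := exists_sdPoint_eq_of_strictMono p
  obtain ⟨n', x', y', hx', hy', rfl⟩ := exists_sdPoint_eq_of_strictMono p'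
  rw [sdNerve_sdPoint, sdNerve_sdPoint] at h
  have hobj (r : Fin (k + 1)) : (y.obj r).map (simplexHom x) = (y'.obj r).map (simplexHom x') := by
    rw [← chainsMap_app_obj, h, chainsMap_app_obj]
  have hr : Set.range x.obj = Set.range x'.obj := by
    ext q
    have h1 : q ∈ ((y.obj (Fin.last k)).map (simplexHom x)).finset ↔
        q ∈ ((y'.obj (Fin.last k)).map (simplexHom x')).finset := by rw [hobj]
    simp only [NonemptyFiniteChains.mem_map_iff, hy, hy', true_and] at h1
    constructor
    · rintro ⟨i, rfl⟩
      obtain ⟨j, hj⟩ := h1.1 ⟨⟨i⟩, rfl⟩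
      exact ⟨j.down, hj⟩
    · rintro ⟨i, rfl⟩
      obtain ⟨j, hj⟩ := h1.2 ⟨⟨i⟩, rfl⟩
      exact ⟨j.down, hj⟩
  obtain rfl : n = n' := eq_of_range_eq hx.injective hx'.injective hr
  obtain rfl : x = x' := nerve.ext_of_isThin ((hx.range_inj hx').1 hr)
  congr 1
  refine nerve.ext_of_isThin (funext fun r => NonemptyFiniteChains.ext (Finset.ext fun i => ?_))
  have hinj : Function.Injective (simplexHom x) := fun i j hij => ULift.ext _ _ (hx.injective hij)
  have h1 : simplexHom x i ∈ ((y.obj r).map (simplexHom x)).finset ↔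
      simplexHom x i ∈ ((y'.obj r).map (simplexHom x)).finset := by rw [hobj]
  simpa [NonemptyFiniteChains.mem_map_iff, hinj.eq_iff] using h1

lemma sdNerve_app_surjective {k : ℕ} : Function.Surjective ((sdNerve Q).app (op ⦋k⦌)) := by
  intro z
  obtain ⟨m, x, y, -, rfl⟩ := exists_chainsMap_simplexHom_eq z
  exact ⟨sdPoint x y, sdNerve_sdPoint x y⟩

instance (Q : Type u) [PartialOrder Q] : IsIso (sdNerve Q) := by
  rw [NatTrans.isIso_iff_isIso_app]
  rintro ⟨k⟩
  induction k using SimplexCategory.rec with | _ k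
  rw [isIso_iff_bijective]
  exact ⟨sdNerve_app_injective, sdNerve_app_surjective⟩

end SubdivisionOfNerve

/-! ### Products of nerves -/

section NerveProducts

variable (S T : Type u) [PartialOrder S] [PartialOrder T]

lemma nerve_finite [Finite S] : (nerve S).Finite := by
  have := Fintype.ofFinite S
  have : (nerve S).HasDimensionLT (Fintype.card S) := ⟨fun n hn => by
    ext x
    simp only [Set.top_eq_univ, Set.mem_univ, iff_true]
    by_contra hx
    rw [← SSet.mem_nonDegenerate_iff_notMem_degenerate,
      PartialOrder.mem_nerve_nonDegenerate_iff_injective] at hx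
    have h := Fintype.card_le_of_injective _ hx
    rw [Fintype.card_fin] at h
    exact absurd (hn.trans_lt (Nat.lt_of_succ_le h)) (lt_irrefl _)⟩
  refine SSet.finite_of_hasDimensionLT _ (Fintype.card S) fun n _ => ?_
  refine Finite.of_injective (β := Fin (n + 1) → S) (fun x => x.1.obj) fun x y h => ?_
  exact Subtype.ext (nerve.ext_of_isThin h)

/-- The product of two partial orders, as a type synonym: it is a category only through its order,
whereas `S × T` also has the product category structure. -/
def OrderProd (S T : Type u) : Type u := S × T

instance : PartialOrder (OrderProd S T) := inferInstanceAs (PartialOrder (S × T))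

/-- The first projection of a product of partial orders. -/
def OrderProd.fst : OrderProd S T →o S := OrderHom.fst (α := S) (β := T)

/-- The second projection of a product of partial orders. -/
def OrderProd.snd : OrderProd S T →o T := OrderHom.snd (α := S) (β := T)

/-- The comparison map from the nerve of a product of partial orders to the product of the
nerves. -/
def nerveProdComparison : nerve (OrderProd S T) ⟶ nerve S ⊗ nerve T :=
  lift (nerveMap (OrderProd.fst S T).monotone.functor)
    (nerveMap (OrderProd.snd S T).monotone.functor)

instance : IsIso (nerveProdComparison S T) := by
  rw [NatTrans.isIso_iff_isIso_app]
  rintro ⟨k⟩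
  induction k using SimplexCategory.rec with | _ k
  rw [isIso_iff_bijective]
  constructor
  · intro x y h
    refine nerve.ext_of_isThin (funext fun i => ?_)
    have h1 := congrArg (fun z : (nerve S ⊗ nerve T : SSet.{u}) _⦋k⦌ => z.1.obj i) h
    have h2 := congrArg (fun z : (nerve S ⊗ nerve T : SSet.{u}) _⦋k⦌ => z.2.obj i) h
    exact Prod.ext h1 h2
  · rintro ⟨x, y⟩
    have h : Monotone (fun i => (x.obj i, y.obj i) : Fin (k + 1) → OrderProd S T) :=
      x.monotone.prodMk y.monotone
    exact ⟨h.functor, rfl⟩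

variable {S T}

lemma push_fst_apply {α β : Type*} [Fintype α] [Fintype β] (w : α × β → ℝ) (i : α) :
    push Prod.fst w i = ∑ j, w (i, j) := by
  classical
  simp only [push]
  rw [← sum_fst_ite w (· = i)]
  simp

lemma push_snd_apply {α β : Type*} [Fintype α] [Fintype β] (w : α × β → ℝ) (j : β) :
    push Prod.snd w j = ∑ i, w (i, j) := by
  classical
  simp only [push]
  rw [← sum_snd_ite w (· = j)]
  simp

/-- A point of the realization of a product of simplicial sets isomorphic to nerves of finite
partial orders is determined by its two projections. -/
lemma eq_of_toTop_map_fst_snd [Finite S] [Finite T] {A B : SSet.{u}} (a : A ≅ nerve S)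
    (b : B ≅ nerve T) {p p' : (|A ⊗ B| : TopCat.{u})}
    (h₁ : SSet.toTop.map (fst A B) p = SSet.toTop.map (fst A B) p')
    (h₂ : SSet.toTop.map (snd A B) p = SSet.toTop.map (snd A B) p') : p = p' := by
  have := Fintype.ofFinite S
  have := Fintype.ofFinite T
  let _ : Fintype (OrderProd S T) := inferInstanceAs (Fintype (S × T))
  let γ : A ⊗ B ⟶ nerve (OrderProd S T) := (a.hom ⊗ₘ b.hom) ≫ inv (nerveProdComparison S T)
  have hγ₁ : γ ≫ nerveMap (OrderProd.fst S T).monotone.functor =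
      fst A B ≫ a.hom := by
    have : nerveMap (OrderProd.fst S T).monotone.functor =
        nerveProdComparison S T ≫ fst _ _ := (lift_fst _ _).symm
    rw [this]
    simp [γ]
  have hγ₂ : γ ≫ nerveMap (OrderProd.snd S T).monotone.functor =
      snd A B ≫ b.hom := by
    have : nerveMap (OrderProd.snd S T).monotone.functor =
        nerveProdComparison S T ≫ snd _ _ := (lift_snd _ _).symm
    rw [this]
    simp [γ]
  have hinj : Function.Injective (SSet.toTop.map γ) :=
    (TopCat.homeoOfIso (asIso (SSet.toTop.map γ))).injective
  refine hinj (weights_injective ?_)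
  refine ChainSupported.eq_of_marginals (P := S) (Q := T) (weights_nonneg _) (weights_nonneg _)
    (chainSupported_weights _) (chainSupported_weights _) (fun i => ?_) (fun j => ?_)
  · have key (q : (|A ⊗ B| : TopCat.{u})) :
        ∑ j, weights (OrderProd S T) (SSet.toTop.map γ q) (i, j) =
          weights S (SSet.toTop.map a.hom (SSet.toTop.map (fst A B) q)) i := by
      refine (push_fst_apply (α := S) (β := T) _ i).symm.trans ?_
      have h := weights_nerveMap (OrderProd.fst S T) (SSet.toTop.map γ q)
      refine (congrFun h i).symm.trans ?_
      rw [toTop_map_map, toTop_map_map, hγ₁]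
    rw [key, key, h₁]
  · have key (q : (|A ⊗ B| : TopCat.{u})) :
        ∑ i, weights (OrderProd S T) (SSet.toTop.map γ q) (i, j) =
          weights T (SSet.toTop.map b.hom (SSet.toTop.map (snd A B) q)) j := by
      refine (push_snd_apply (α := S) (β := T) _ j).symm.trans ?_
      have h := weights_nerveMap (OrderProd.snd S T) (SSet.toTop.map γ q)
      refine (congrFun h j).symm.trans ?_
      rw [toTop_map_map, toTop_map_map, hγ₂]
    rw [key, key, h₂]

end NerveProducts

/-- The realization of a finite simplicial set is a finite union of images of simplices. -/
instance compactSpace_toTop (X : SSet.{u}) [X.Finite] : CompactSpace (|X| : TopCat.{u}) := by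
  have h : (Set.univ : Set (|X| : TopCat.{u})) =
      ⋃ s : X.N, Set.range (SSet.toTop.map (SSet.yonedaEquiv.symm s.simplex)) := by
    refine (Set.eq_univ_of_forall fun p => Set.mem_iUnion.2 ?_).symm
    obtain ⟨n, x, y, rfl⟩ := exists_toTop_map_eq p
    induction n using SimplexCategory.rec with | _ n
    obtain ⟨m, f, -, z, rfl⟩ := X.exists_nonDegenerate x
    refine ⟨SSet.N.mk z.1 z.2, SSet.toTop.map (SSet.stdSimplex.map f) y, ?_⟩
    rw [← SSet.yonedaEquiv_symm_naturality_left, Functor.map_comp]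
    rfl
  refine ⟨h ▸ isCompact_iUnion fun s => ?_⟩
  have : CompactSpace (|SSet.stdSimplex.obj ⦋s.dim⦌| : TopCat.{u}) :=
    (SimplexCategory.toTopHomeo ⦋s.dim⦌).symm.compactSpace
  exact isCompact_range (by fun_prop)

/-! ### Layer coordinates -/

section LayerCoordinates

open PartialOrder

variable {U : Type u} [PartialOrder U]

/-- The subdivision of a simplicial set isomorphic to the nerve of a partial order is the nerve
of the partial order of nonempty finite chains. -/
noncomputable def sdIsoNerve {X : SSet.{u}} (e : X ≅ nerve U) :
    SSet.sd.obj X ≅ nerve (NonemptyFiniteChains U) :=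
  SSet.sd.mapIso e ≪≫ asIso (sdNerve U)

/-- Coordinates on the realization of the subdivision of the nerve of a finite partial order: the
layer sum of the barycentric coordinates. -/
noncomputable def layerCoord [Finite U] {X : SSet.{u}} (e : X ≅ nerve U)
    (p : (|SSet.sd.obj X| : TopCat.{u})) : U → ℝ :=
  layerSum (weights _ (SSet.toTop.map (sdIsoNerve e).hom p))

variable [Finite U] {X : SSet.{u}} (e : X ≅ nerve U)

lemma continuous_layerCoord : Continuous (layerCoord e) := by
  refine continuous_pi fun q => continuous_finsetSum _ fun C _ => ?_
  split_ifs
  · have h : Continuous fun p => weights _ (SSet.toTop.map (sdIsoNerve e).hom p) := by fun_prop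
    exact (continuous_apply C).comp h
  · exact continuous_const

lemma layerCoord_nonneg (p : (|SSet.sd.obj X| : TopCat.{u})) : 0 ≤ layerCoord e p :=
  layerSum_nonneg (weights_nonneg _)

lemma chainSupported_layerCoord (p : (|SSet.sd.obj X| : TopCat.{u})) :
    ChainSupported (layerCoord e p) :=
  chainSupported_layerSum (chainSupported_weights _)

lemma isGreatest_layerCoord [Nonempty U] (p : (|SSet.sd.obj X| : TopCat.{u})) :
    IsGreatest (Set.range (layerCoord e p)) 1 := by
  rw [← sum_weights (SSet.toTop.map (sdIsoNerve e).hom p)]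
  exact isGreatest_range_layerSum (weights_nonneg _) (chainSupported_weights _)

lemma layerCoord_injective : Function.Injective (layerCoord e) := by
  intro p p' h
  have h1 := layerSum_injective (weights_nonneg _) (weights_nonneg _) (chainSupported_weights _)
    (chainSupported_weights _) h
  exact (TopCat.homeoOfIso (SSet.toTop.mapIso (sdIsoNerve e))).injective (weights_injective h1)

lemma exists_layerCoord_eq [Nonempty U] {h : U → ℝ} (h0 : 0 ≤ h) (hc : ChainSupported h)
    (h1 : IsGreatest (Set.range h) 1) : ∃ p, layerCoord e p = h := by
  obtain ⟨w, hw0, hwc, rfl, -⟩ := exists_layerSum_eq h0 hc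
  obtain ⟨q, rfl⟩ := exists_weights_eq hw0 hwc ((isGreatest_range_layerSum hw0 hwc).unique h1)
  obtain ⟨p, rfl⟩ :=
    (TopCat.homeoOfIso (SSet.toTop.mapIso (sdIsoNerve e))).surjective q
  exact ⟨p, rfl⟩

/-- Layer coordinates transform under a map induced by a monotone map by taking maxima over the
fibres. -/
lemma isGreatest_layerCoord_map {V : Type u} [PartialOrder V] [Finite V] {Y : SSet.{u}}
    (e' : Y ≅ nerve V) (f : U →o V) {g : X ⟶ Y}
    (hg : g ≫ e'.hom = e.hom ≫ nerveMap f.monotone.functor)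
    (p : (|SSet.sd.obj X| : TopCat.{u})) {v : V} (hv : ∃ q, f q = v) :
    IsGreatest (layerCoord e p '' {q | f q = v})
      (layerCoord e' (SSet.toTop.map (SSet.sd.map g) p) v) := by
  have h : SSet.sd.map g ≫ (sdIsoNerve e').hom = (sdIsoNerve e).hom ≫ chainsMap f := by
    simp only [sdIsoNerve, Iso.trans_hom, Functor.mapIso_hom, asIso_hom]
    rw [← Category.assoc, ← Functor.map_comp, hg, Functor.map_comp, Category.assoc,
      sdNerve_naturality, Category.assoc]
  have h3 : weights _ (SSet.toTop.map (sdIsoNerve e').hom (SSet.toTop.map (SSet.sd.map g) p)) =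
      push (NonemptyFiniteChains.orderHomMap f)
        (weights _ (SSet.toTop.map (sdIsoNerve e).hom p)) := by
    rw [toTop_map_map, h, ← toTop_map_map]
    exact weights_nerveMap _ _
  unfold layerCoord
  rw [h3]
  exact isGreatest_layerSum_push f (weights_nonneg _) (chainSupported_weights _) hv

end LayerCoordinates

/-! ### Fibres of the comparison map -/

section Fibre

variable (m n : ℕ)

/-- The first projection `[m] × [n] → [m]`, lifted to the universe `u`. -/
def uliftFst : ULift.{u} (Fin (m + 1) × Fin (n + 1)) →o ULift.{u} (Fin (m + 1)) where
  toFun x := ⟨x.down.1⟩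
  monotone' _ _ h := h.1

/-- The second projection `[m] × [n] → [n]`, lifted to the universe `u`. -/
def uliftSnd : ULift.{u} (Fin (m + 1) × Fin (n + 1)) →o ULift.{u} (Fin (n + 1)) where
  toFun x := ⟨x.down.2⟩
  monotone' _ _ h := h.2

/-- Layer coordinates on the realization of `Sd (Δ[m] × Δ[n])`. -/
noncomputable def prodCoord (p : (|SSet.sd.obj (Δ[m] ⊗ Δ[n] : SSet.{u})| : TopCat.{u}))
    (x : Fin (m + 1) × Fin (n + 1)) : ℝ :=
  layerCoord (SSet.prodStdSimplex.isoNerve m n) p ⟨x⟩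

/-- Layer coordinates on the realization of `Sd Δ[n]`. -/
noncomputable def simplexCoord (p : (|SSet.sd.obj (Δ[n] : SSet.{u})| : TopCat.{u}))
    (i : Fin (n + 1)) : ℝ :=
  layerCoord (SSet.stdSimplex.isoNerve n) p ⟨i⟩

variable {m n}

lemma simplexCoord_injective : Function.Injective (simplexCoord.{u} n) := fun _ _ h =>
  layerCoord_injective (SSet.stdSimplex.isoNerve n) (funext fun i => congrFun h (ULift.down i))

lemma prodCoord_injective : Function.Injective (prodCoord.{u} m n) := fun _ _ h =>
  layerCoord_injective (SSet.prodStdSimplex.isoNerve m n)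
    (funext fun x => congrFun h (ULift.down x))

lemma continuous_prodCoord : Continuous (prodCoord.{u} m n) :=
  continuous_pi fun x => (continuous_apply (ULift.up x)).comp (continuous_layerCoord _)

lemma isGreatest_range_ulift {α : Type*} {f : ULift.{u} α → ℝ} {c : ℝ} :
    IsGreatest (Set.range f) c ↔ IsGreatest (Set.range fun i => f ⟨i⟩) c := by
  rw [← ULift.up_surjective.range_comp f]
  rfl

lemma isGreatest_simplexCoord (p : (|SSet.sd.obj (Δ[n] : SSet.{u})| : TopCat.{u})) :
    IsGreatest (Set.range (simplexCoord n p)) 1 :=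
  isGreatest_range_ulift.1 (isGreatest_layerCoord _ p)

lemma simplexCoord_nonneg (p : (|SSet.sd.obj (Δ[n] : SSet.{u})| : TopCat.{u})) :
    0 ≤ simplexCoord n p := fun _ => layerCoord_nonneg _ p _

/-- The layer coordinates of the first component of the comparison map are row maxima. -/
lemma isGreatest_prodCoord_fst (p : (|SSet.sd.obj (Δ[m] ⊗ Δ[n] : SSet.{u})| : TopCat.{u}))
    (i : Fin (m + 1)) :
    IsGreatest (Set.range fun j => prodCoord m n p (i, j))
      (simplexCoord m (SSet.toTop.map (SSet.sd.map (fst _ _)) p) i) := by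
  have h := isGreatest_layerCoord_map (SSet.prodStdSimplex.isoNerve.{u} m n)
    (SSet.stdSimplex.isoNerve m) (uliftFst m n) (g := fst _ _) rfl p (v := ⟨i⟩) ⟨⟨i, 0⟩, rfl⟩
  refine (congrArg (IsGreatest · _) (Set.ext fun c => ?_)).mpr h
  constructor
  · rintro ⟨j, rfl⟩
    exact ⟨⟨i, j⟩, rfl, rfl⟩
  · rintro ⟨⟨i', j⟩, hq, rfl⟩
    obtain rfl : i' = i := congrArg ULift.down hq
    exact ⟨j, rfl⟩

/-- The layer coordinates of the second component of the comparison map are column maxima. -/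
lemma isGreatest_prodCoord_snd (p : (|SSet.sd.obj (Δ[m] ⊗ Δ[n] : SSet.{u})| : TopCat.{u}))
    (j : Fin (n + 1)) :
    IsGreatest (Set.range fun i => prodCoord m n p (i, j))
      (simplexCoord n (SSet.toTop.map (SSet.sd.map (snd _ _)) p) j) := by
  have h := isGreatest_layerCoord_map (SSet.prodStdSimplex.isoNerve.{u} m n)
    (SSet.stdSimplex.isoNerve n) (uliftSnd m n) (g := snd _ _) rfl p (v := ⟨j⟩) ⟨⟨0, j⟩, rfl⟩
  refine (congrArg (IsGreatest · _) (Set.ext fun c => ?_)).mpr h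
  constructor
  · rintro ⟨i, rfl⟩
    exact ⟨⟨i, j⟩, rfl, rfl⟩
  · rintro ⟨⟨i, j'⟩, hq, rfl⟩
    obtain rfl : j' = j := congrArg ULift.down hq
    exact ⟨i, rfl⟩

lemma exists_prodCoord_eq {h : Fin (m + 1) × Fin (n + 1) → ℝ} (h0 : 0 ≤ h)
    (hc : ChainSupported h) (h1 : IsGreatest (Set.range h) 1) :
    ∃ p, prodCoord.{u} m n p = h := by
  obtain ⟨p, hp⟩ := exists_layerCoord_eq (SSet.prodStdSimplex.isoNerve.{u} m n)
    (h := fun x => h x.down) (fun x => h0 _) (fun x y hx hy => hc _ _ hx hy)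
    (isGreatest_range_ulift.2 h1)
  exact ⟨p, funext fun x => congrFun hp ⟨x⟩⟩

lemma sd_finite {U : Type u} [PartialOrder U] [Finite U] {X : SSet.{u}} (e : X ≅ nerve U) :
    (SSet.sd.obj X).Finite :=
  have := nerve_finite (PartialOrder.NonemptyFiniteChains U)
  SSet.finite_of_iso (sdIsoNerve e).symm

lemma map_fst_sdProdComparison {X Y : SSet.{u}} (p : (|SSet.sd.obj (X ⊗ Y)| : TopCat.{u})) :
    SSet.toTop.map (fst _ _) (SSet.toTop.map (SSet.sdProdComparison X Y) p) =
      SSet.toTop.map (SSet.sd.map (fst X Y)) p := by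
  rw [toTop_map_map, SSet.sdProdComparison, lift_fst]

lemma map_snd_sdProdComparison {X Y : SSet.{u}} (p : (|SSet.sd.obj (X ⊗ Y)| : TopCat.{u})) :
    SSet.toTop.map (snd _ _) (SSet.toTop.map (SSet.sdProdComparison X Y) p) =
      SSet.toTop.map (SSet.sd.map (snd X Y)) p := by
  rw [toTop_map_map, SSet.sdProdComparison, lift_snd]

/-- In layer coordinates, the fibre of the comparison map over a point is the space of functions
supported on a chain with prescribed row and column maxima. -/
lemma image_prodCoord_fibre
    (b : (|SSet.sd.obj (Δ[m] : SSet.{u}) ⊗ SSet.sd.obj (Δ[n] : SSet.{u})| : TopCat.{u})) :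
    prodCoord m n '' ((SSet.toTop.map (SSet.sdProdComparison Δ[m] Δ[n])).hom ⁻¹' {b}) =
      maxCouplings (simplexCoord m (SSet.toTop.map (fst _ _) b))
        (simplexCoord n (SSet.toTop.map (snd _ _) b)) := by
  ext h
  constructor
  · rintro ⟨p, hp, rfl⟩
    obtain rfl : SSet.toTop.map (SSet.sdProdComparison Δ[m] Δ[n]) p = b := hp
    rw [map_fst_sdProdComparison, map_snd_sdProdComparison]
    exact ⟨fun x => layerCoord_nonneg _ p _,
      fun x y hx hy => chainSupported_layerCoord _ p _ _ hx hy,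
      isGreatest_prodCoord_fst p, isGreatest_prodCoord_snd p⟩
  · rintro ⟨h0, hc, h1, h2⟩
    obtain ⟨⟨i₀, hi₀⟩, hmax⟩ := isGreatest_simplexCoord (SSet.toTop.map (fst _ _) b)
    obtain ⟨p, rfl⟩ := exists_prodCoord_eq.{u} h0 hc (by
      constructor
      · obtain ⟨j, hj⟩ := (h1 i₀).1
        exact ⟨(i₀, j), hj.trans hi₀⟩
      · rintro _ ⟨x, rfl⟩
        exact ((h1 x.1).2 ⟨x.2, rfl⟩).trans (hmax ⟨x.1, rfl⟩))
    refine ⟨p, ?_, rfl⟩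
    refine eq_of_toTop_map_fst_snd (sdIsoNerve (SSet.stdSimplex.isoNerve m))
      (sdIsoNerve (SSet.stdSimplex.isoNerve n)) ?_ ?_
    · refine simplexCoord_injective (funext fun i => ?_)
      refine Eq.trans ?_ ((isGreatest_prodCoord_fst p i).unique (h1 i))
      exact congrFun (congrArg _ (map_fst_sdProdComparison p)) i
    · refine simplexCoord_injective (funext fun j => ?_)
      refine Eq.trans ?_ ((isGreatest_prodCoord_snd p j).unique (h2 j))
      exact congrFun (congrArg _ (map_snd_sdProdComparison p)) j

end Fibre

end SdProd

theorem proposition1p3 (m n : ℕ) :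
    SSet.IsSimple (SSet.sdProdComparison (Δ[m] : SSet.{u}) (Δ[n] : SSet.{u})) := by
  have h₁ := SdProd.sd_finite (SSet.prodStdSimplex.isoNerve.{u} m n)
  have h₂ := SdProd.sd_finite (SSet.stdSimplex.isoNerve.{u} m)
  have h₃ := SdProd.sd_finite (SSet.stdSimplex.isoNerve.{u} n)
  refine ⟨h₁, inferInstance, fun b => ?_⟩
  have hemb : Topology.IsEmbedding (SdProd.prodCoord.{u} m n) :=
    (SdProd.continuous_prodCoord.isClosedEmbedding SdProd.prodCoord_injective).isEmbedding
  have := SdProd.contractibleSpace_maxCouplings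
    (SdProd.simplexCoord_nonneg (SSet.toTop.map (fst _ _) b))
    (SdProd.simplexCoord_nonneg (SSet.toTop.map (snd _ _) b))
    (SdProd.isGreatest_simplexCoord _) (SdProd.isGreatest_simplexCoord _)
  rw [← SdProd.image_prodCoord_fibre b] at this
  exact (hemb.homeomorphImage _).contractibleSpace
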